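/- Let $R$ be a ring. Let $\mathrm{Mod}(R)$ be the category of right $R$-modules, $\mathrm{mod}(R^{op})$ the category of finitely presented left $R$-modules, and $(\mathrm{mod}(R^{op}),\mathrm{Ab})$ the category of additive functors $\mathrm{mod}(R^{op})\to\mathrm{Ab}$. Let $\mathrm{fp}(\mathrm{Mod}(R),\mathrm{Ab})$ be the category of finitely presented functors $F:\mathrm{Mod}(R)\to\mathrm{Ab}$, i.e. those admitting an exact sequence $(Y,-)\to(X,-)\to F\to 0$ with $X,Y\in\mathrm{Mod}(R)$, where $(X,-)=\mathrm{Hom}_R(X,-)$. Consider the following functors. * $t:\mathrm{Mod}(R)\to(\mathrm{mod}(R^{op}),\mathrm{Ab})$, $t(X)=X\otimes_R -$, and $\mathrm{ev}_R:(\mathrm{mod}(R^{op}),\mathrm{Ab})\to\mathrm{Mod}(R)$, $\mathrm{ev}_R(G)=G(R)$. * The contravariant Yoneda embedding $Y:\mathrm{Mod}(R)\to\mathrm{fp}(\mathrm{Mod}(R),\mathrm{Ab})$, $Y(X)=(X,-)$, and its adjoint, the contravariant functor $w:\mathrm{fp}(\mathrm{Mod}(R),\mathrm{Ab})\to\mathrm{Mod}(R)$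 with $\mathrm{Nat}(F,(X,-))\cong\mathrm{Hom}_R(X,w(F))$. * The Auslander–Gruson–Jensen functor $D_A$, contravariant from $\mathrm{fp}(\mathrm{Mod}(R),\mathrm{Ab})$ to $(\mathrm{mod}(R^{op}),\mathrm{Ab})$: the zeroth right derived functor (computed with projective resolutions) of the contravariant functor $t\circ w$. There are canonical morphisms $X\otimes-\to D_A(X,-)$. * $D_L$, contravariant from $(\mathrm{mod}(R^{op}),\mathrm{Ab})$ to $\mathrm{fp}(\mathrm{Mod}(R),\mathrm{Ab})$: the zeroth left derived functor (computed with injective resolutions) of the contravariant functor $Y\circ\mathrm{ev}_R$, $G\mapsto(G(R),-)$. * $D_R$, contravariant in $G\in(\mathrm{mod}(R^{op}),\mathrm{Ab})$: $(D_RG)(M)=\mathrm{Nat}(G,M\otimes_R-)$ for $M\in\mathrm{Mod}(R)$. Let $\ker(D_A)$ be the full subcategory of $\mathrm{fp}(\mathrm{Mod}(R),\mathrm{Ab})$ of all $F$ with $D_AF=0$, and $i$ its inclusion. Then $D_RG$ is finitely presented for every $G$. Regarding $D_A$ as a covariant functor $\mathrm{fp}(\mathrm{Mod}(R),\mathrm{Ab})\to(\mathrm{mod}(R^{op}),\mathrm{Ab})^{op}$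 and $D_L,D_R$ as covariant functors in the opposite direction, there are adjunctions $D_L\dashv D_A\dashv D_R$ such that * the counit $\gamma:D_LD_A\to 1$ of $D_L\dashv D_A$ is, on each representable functor $(X,-)$, the composite of canonical maps $D_LD_A(X,-)\to D_L(X\otimes-)\to(X\otimes_R R,-)\cong(X,-)$; * the unit $\delta:1\to D_RD_A$ of $D_A\dashv D_R$ is, on each $(X,-)$, the morphism $(X,-)\to D_RD_A(X,-)=\mathrm{Nat}(D_A(X,-),(?)\otimes-)$ which corresponds under the Yoneda lemma to a natural transformation $D_A(X,-)\to X\otimes-$ whose composite with the canonical map $X\otimes-\to D_A(X,-)$ (applied first) is the identity of $X\otimes -$. For $F\in\mathrm{fp}(\mathrm{Mod}(R),\mathrm{Ab})$ put $F^p=\operatorname{coker}(\gamma_F:D_LD_AF\to F)$ and $F_q=\ker(\delta_F:F\to D_RD_AF)$. Then $F^p$ and $F_q$ lie in $\ker(D_A)$, and the functors $i,(-)^p,(-)_q$ together with $D_L,D_A,D_R$ form a recollement $$\ker(D_A)\longrightarrow\mathrm{fp}(\mathrm{Mod}(R),\mathrm{Ab})\longrightarrow(\mathrm{mod}(R^{op}),\mathrm{Ab})^{op},$$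 that is: 1. the three categories are abelian and all six functors are additive; 2. $D_L\dashv D_A\dashv D_R$, by the adjunctions above, and the unit $1\to D_AD_L$ and the counit $D_AD_R\to1$ are isomorphisms; 3. $(-)^p\dashv i\dashv(-)_q$, and the counit $(i(-))^p\to1$ and the unit $1\to(i(-))_q$ are isomorphisms; 4. $i$ is fully faithful, and its essential image consists exactly of the objects $F$ of $\mathrm{fp}(\mathrm{Mod}(R),\mathrm{Ab})$ with $D_AF=0$. -/

import Mathlib

open CategoryTheory CategoryTheory.Limits Opposite
universe v u w
noncomputable section
namespace AGJ

section Generic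
variable {J : Type u} [Category.{v} J]

lemma app_injective_of_mono {F G : J ⥤ AddCommGrpCat.{w}} (f : F ⟶ G) [Mono f] (A : J) :
    Function.Injective (f.app A) :=
  (AddCommGrpCat.mono_iff_injective _).1 inferInstance

lemma app_surjective_of_epi {F G : J ⥤ AddCommGrpCat.{w}} (f : F ⟶ G) [Epi f] (A : J) :
    Function.Surjective (f.app A) :=
  (AddCommGrpCat.epi_iff_surjective _).1 inferInstance

lemma app_exact {S : ShortComplex (J ⥤ AddCommGrpCat.{w})} (h : S.Exact) (A : J) :
    Function.Exact (S.f.app A) (S.g.app A) :=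
  (ShortComplex.ab_exact_iff_function_exact _).1 (h.map ((evaluation J AddCommGrpCat.{w}).obj A))

lemma exact_of_app {S : ShortComplex (J ⥤ AddCommGrpCat.{w})}
    (h : ∀ A, Function.Exact (S.f.app A) (S.g.app A)) : S.Exact := by
  rw [ShortComplex.exact_iff_isZero_homology, Functor.isZero_iff]
  intro A
  have h1 : (S.map ((evaluation J AddCommGrpCat.{w}).obj A)).Exact :=
    (ShortComplex.ab_exact_iff_function_exact _).2 (h A)
  rw [ShortComplex.exact_iff_isZero_homology] at h1
  exact h1.of_iso (S.mapHomologyIso ((evaluation J AddCommGrpCat.{w}).obj A)).symm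

lemma epi_of_app_surjective {F G : J ⥤ AddCommGrpCat.{w}} (f : F ⟶ G)
    (h : ∀ A, Function.Surjective (f.app A)) : Epi f := by
  have : ∀ A, Epi (f.app A) := fun A => (AddCommGrpCat.epi_iff_surjective _).2 (h A)
  exact NatTrans.epi_of_epi_app f

lemma mono_of_app_injective {F G : J ⥤ AddCommGrpCat.{w}} (f : F ⟶ G)
    (h : ∀ A, Function.Injective (f.app A)) : Mono f := by
  have : ∀ A, Mono (f.app A) := fun A => (AddCommGrpCat.mono_iff_injective _).2 (h A)
  exact NatTrans.mono_of_mono_app f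

end Generic

section FP
variable {A : Type u} [Category.{v} A] [Abelian A]

/-- The covariant representable functor `(X, -) : A ⥤ Ab`. -/
abbrev Rep (X : A) : A ⥤ AddCommGrpCat.{v} := preadditiveCoyoneda.obj (op X)

/-- Finitely presented functors `F : A ⥤ Ab`: there is a sequence `(Y, -) ⟶ (X, -) ⟶ F ⟶ 0`
which is exact at every object. (Such an `F` is automatically additive, see `IsFP.additive`.) -/
def IsFP : ObjectProperty (A ⥤ AddCommGrpCat.{v}) := fun F =>
  ∃ (X Y : A) (a : Rep Y ⟶ Rep X) (p : Rep X ⟶ F),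
    ∀ M : A, Function.Exact (a.app M) (p.app M) ∧ Function.Surjective (p.app M)

lemma isFP_iff (F : A ⥤ AddCommGrpCat.{v}) : IsFP F ↔ ∃ (X Y : A) (a : X ⟶ Y) (p : Rep X ⟶ F),
    ∀ M : A, (∀ g : X ⟶ M, p.app M g = 0 ↔ ∃ h : Y ⟶ M, a ≫ h = g) ∧
      ∀ z : F.obj M, ∃ g : X ⟶ M, p.app M g = z := by
  constructor
  · rintro ⟨X, Y, a, p, h⟩
    obtain ⟨a, rfl⟩ := preadditiveCoyoneda.map_surjective a
    exact ⟨X, Y, a.unop, p, fun M => ⟨fun g => (h M).1 g, (h M).2⟩⟩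
  · rintro ⟨X, Y, a, p, h⟩
    exact ⟨X, Y, preadditiveCoyoneda.map a.op, p, fun M => ⟨fun g => (h M).1 g, (h M).2⟩⟩

lemma nat {F : A ⥤ AddCommGrpCat.{v}} {X : A} (p : Rep X ⟶ F) {M N : A} (g : X ⟶ M) (h : M ⟶ N) :
    p.app N (g ≫ h) = F.map h (p.app M g) :=
  ConcreteCategory.congr_hom (p.naturality h) g

lemma lift_rep {X Y : A} {F G : A ⥤ AddCommGrpCat.{v}} (p : Rep X ⟶ F) (f : F ⟶ G) (q : Rep Y ⟶ G)
    (hq : ∀ (M : A) (z : G.obj M), ∃ g : Y ⟶ M, q.app M g = z) :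
    ∃ b : Y ⟶ X, ∀ (M : A) (g : X ⟶ M), f.app M (p.app M g) = q.app M (b ≫ g) := by
  obtain ⟨b, hb⟩ := hq X (f.app X (p.app X (𝟙 X)))
  refine ⟨b, fun M g => ?_⟩
  have h1 := nat (p ≫ f) (𝟙 X) g
  have h2 := nat q b g
  rw [h2, hb]
  rw [Category.id_comp] at h1
  exact h1

lemma isFP_of_exact_kernel {F G K : A ⥤ AddCommGrpCat.{v}} (hF : IsFP F) (hG : IsFP G)
    (k : K ⟶ F) (f : F ⟶ G) (hk : ∀ M, Function.Injective (k.app M))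
    (hkf : ∀ M, Function.Exact (k.app M) (f.app M)) : IsFP K := by
  rw [isFP_iff] at hF hG ⊢
  obtain ⟨X, Y, a, p, hp⟩ := hF
  obtain ⟨X', Y', a', q, hq⟩ := hG
  obtain ⟨b, hb⟩ := lift_rep p f q fun M => (hq M).2
  have hc : f.app _ (p.app _ (pushout.inr a' b)) = 0 := by
    rw [hb, (hq _).1]
    exact ⟨pushout.inl a' b, pushout.condition⟩
  obtain ⟨x, hx⟩ := (hkf _ _).1 hc
  obtain ⟨r, hr⟩ : ∃ r : Rep (pushout a' b) ⟶ K, ∀ M (g : pushout a' b ⟶ M),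
      k.app M (r.app M g) = p.app M (pushout.inr a' b ≫ g) := by
    have hFadd : ∀ (M) (g h : pushout a' b ⟶ M), K.map (g + h) x = K.map g x + K.map h x := by
      intro M g h
      have e : ∀ g : pushout a' b ⟶ M, k.app M (K.map g x) = p.app M (pushout.inr a' b ≫ g) := by
        intro g
        rw [nat, ← hx]
        exact ConcreteCategory.congr_hom (k.naturality g) x
      apply hk M
      rw [map_add, e, e, e, Preadditive.comp_add]
      exact map_add (p.app M).hom _ _
    refine ⟨{ app := fun M => AddCommGrpCat.ofHom
                (AddMonoidHom.mk' (fun g : pushout a' b ⟶ M => K.map g x) (hFadd M))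
              naturality := ?_ }, ?_⟩
    · intro M N h
      ext (g : pushout a' b ⟶ M)
      exact ConcreteCategory.congr_hom (K.map_comp g h) x
    · intro M g
      change k.app M (K.map g x) = _
      rw [nat, ← hx]
      exact ConcreteCategory.congr_hom (k.naturality g) x
  refine ⟨pushout a' b, pushout a (pushout.inr a' b), pushout.inr a (pushout.inr a' b), r,
    fun M => ⟨fun g => ?_, fun z => ?_⟩⟩
  · rw [← map_eq_zero_iff (k.app M).hom (hk M)]
    change k.app M (r.app M g) = 0 ↔ _
    rw [hr, (hp M).1]
    constructor
    · rintro ⟨h, hh⟩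
      exact ⟨pushout.desc h g hh, pushout.inr_desc _ _ _⟩
    · rintro ⟨h, rfl⟩
      exact ⟨pushout.inl a (pushout.inr a' b) ≫ h, by rw [pushout.condition_assoc]⟩
  · obtain ⟨g, hg⟩ := (hp M).2 (k.app M z)
    have h0 : f.app M (p.app M g) = 0 := by
      rw [hg]; exact (hkf M _).2 ⟨z, rfl⟩
    rw [hb, (hq M).1] at h0
    obtain ⟨h, hh⟩ := h0
    refine ⟨pushout.desc h g hh, hk M ?_⟩
    rw [hr, ← hg, pushout.inr_desc]

lemma isFP_of_exact_cokernel {F G C : A ⥤ AddCommGrpCat.{v}} (hF : IsFP F) (hG : IsFP G)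
    (f : F ⟶ G) (c : G ⟶ C) (hc : ∀ M, Function.Surjective (c.app M))
    (hfc : ∀ M, Function.Exact (f.app M) (c.app M)) : IsFP C := by
  rw [isFP_iff] at hF hG ⊢
  obtain ⟨X, Y, a, p, hp⟩ := hF
  obtain ⟨X', Y', a', q, hq⟩ := hG
  obtain ⟨b, hb⟩ := lift_rep p f q fun M => (hq M).2
  refine ⟨X', X ⊞ Y', biprod.lift b a', q ≫ c, fun M => ⟨fun g => ?_, ?_⟩⟩
  · change c.app M (q.app M g) = 0 ↔ _
    rw [hfc M]
    constructor
    · rintro ⟨y, hy⟩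
      obtain ⟨h, rfl⟩ := (hp M).2 y
      rw [hb] at hy
      have : q.app M (g - b ≫ h) = 0 := by
        refine (map_sub (q.app M).hom _ _).trans ?_
        rw [sub_eq_zero]; exact hy.symm
      obtain ⟨h', hh'⟩ := ((hq M).1 (g - b ≫ h)).1 this
      refine ⟨biprod.desc h h', ?_⟩
      rw [biprod.lift_desc, hh']; abel
    · rintro ⟨m, rfl⟩
      refine ⟨p.app M (biprod.inl ≫ m), ?_⟩
      rw [hb]
      have : biprod.lift b a' ≫ m = b ≫ biprod.inl ≫ m + a' ≫ biprod.inr ≫ m := by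
        rw [biprod.lift_eq]; simp
      rw [this]
      refine Eq.trans ?_ (map_add (q.app M).hom _ _).symm
      have h0 : q.app M (a' ≫ biprod.inr ≫ m) = 0 := ((hq M).1 _).2 ⟨_, rfl⟩
      change _ = q.app M _ + q.app M _
      rw [h0, add_zero]
  · intro z
    obtain ⟨y, rfl⟩ := hc M z
    obtain ⟨g, rfl⟩ := (hq M).2 y
    exact ⟨g, rfl⟩

lemma isFP_of_prod {F G P : A ⥤ AddCommGrpCat.{v}} (hF : IsFP F) (hG : IsFP G)
    (f : P ⟶ F) (g : P ⟶ G) (i : F ⟶ P) (j : G ⟶ P) (hif : i ≫ f = 𝟙 _) (hjg : j ≫ g = 𝟙 _)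
    (hig : i ≫ g = 0) (hjf : j ≫ f = 0) (hs : f ≫ i + g ≫ j = 𝟙 _) : IsFP P := by
  rw [isFP_iff] at hF hG ⊢
  obtain ⟨X, Y, a, p, hp⟩ := hF
  obtain ⟨X', Y', a', q, hq⟩ := hG
  refine ⟨X ⊞ X', Y ⊞ Y', biprod.map a a', preadditiveCoyoneda.map biprod.inl.op ≫ p ≫ i +
    preadditiveCoyoneda.map biprod.inr.op ≫ q ≫ j, fun M => ?_⟩
  have e : ∀ m : X ⊞ X' ⟶ M, (preadditiveCoyoneda.map biprod.inl.op ≫ p ≫ i +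
    preadditiveCoyoneda.map biprod.inr.op ≫ q ≫ j).app M m =
      i.app M (p.app M (biprod.inl ≫ m)) + j.app M (q.app M (biprod.inr ≫ m)) := fun m => rfl
  have e1 : ∀ x, f.app M (i.app M x) = x := fun x =>
    ConcreteCategory.congr_hom (congr_app hif M) x
  have e2 : ∀ x, g.app M (j.app M x) = x := fun x =>
    ConcreteCategory.congr_hom (congr_app hjg M) x
  have e3 : ∀ x, g.app M (i.app M x) = 0 := fun x =>
    ConcreteCategory.congr_hom (congr_app hig M) x
  have e4 : ∀ x, f.app M (j.app M x) = 0 := fun x =>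
    ConcreteCategory.congr_hom (congr_app hjf M) x
  have e5 : ∀ x, i.app M (f.app M x) + j.app M (g.app M x) = x := fun x =>
    ConcreteCategory.congr_hom (congr_app hs M) x
  refine ⟨fun m => ?_, fun z => ?_⟩
  · rw [e]
    constructor
    · intro h
      have h1 := congrArg (f.app M) h
      have h2 := congrArg (g.app M) h
      rw [map_add, e1, e4, map_zero, add_zero, (hp M).1] at h1
      rw [map_add, e2, e3, map_zero, zero_add, (hq M).1] at h2
      obtain ⟨u, hu⟩ := h1
      obtain ⟨u', hu'⟩ := h2
      refine ⟨biprod.desc u u', ?_⟩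
      ext <;> simp [hu, hu']
    · rintro ⟨h, rfl⟩
      rw [((hp M).1 _).2 ⟨biprod.inl ≫ h, by simp⟩, ((hq M).1 _).2 ⟨biprod.inr ≫ h, by simp⟩,
        map_zero, map_zero, add_zero]
  · obtain ⟨m, hm⟩ := (hp M).2 (f.app M z)
    obtain ⟨m', hm'⟩ := (hq M).2 (g.app M z)
    refine ⟨biprod.desc m m', ?_⟩
    rw [e, biprod.inl_desc, biprod.inr_desc, hm, hm', e5]

lemma isFP_rep (X : A) : IsFP (Rep X) := by
  rw [isFP_iff]
  refine ⟨X, ⊥_ A, 0, 𝟙 _, fun M => ⟨fun g => ?_, fun g => ⟨g, rfl⟩⟩⟩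
  change g = 0 ↔ _
  constructor
  · rintro rfl
    exact ⟨0, by simp⟩
  · rintro ⟨h, rfl⟩
    simp

instance : (IsFP (A := A)).ContainsZero where
  exists_zero := ⟨Rep (⊥_ A), by
    rw [IsZero.iff_id_eq_zero]
    ext M (g : (⊥_ A) ⟶ M)
    exact initialIsInitial.hom_ext _ _, isFP_rep _⟩

instance : (IsFP (A := A)).IsClosedUnderKernels where
  kernels_le := by
    rintro _ ⟨f, k, hk, hf⟩
    have := Fork.IsLimit.mono hk
    exact isFP_of_exact_kernel hf.1 hf.2 k.ι f (app_injective_of_mono _)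
      (app_exact (S := .mk k.ι f k.condition)
        (ShortComplex.exact_of_f_is_kernel _ (IsLimit.ofIsoLimit hk (Fork.ext (Iso.refl _)))))

instance : (IsFP (A := A)).IsClosedUnderCokernels where
  cokernels_le := by
    rintro _ ⟨f, k, hk, hf⟩
    have := Cofork.IsColimit.epi hk
    exact isFP_of_exact_cokernel hf.1 hf.2 f k.π (app_surjective_of_epi _)
      (app_exact (S := .mk f k.π k.condition)
        (ShortComplex.exact_of_g_is_cokernel _ (IsColimit.ofIsoColimit hk (Cofork.ext (Iso.refl _)))))

instance : (IsFP (A := A)).IsClosedUnderIsomorphisms where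
  of_iso := by
    rintro F G e ⟨X, Y, a, p, h⟩
    refine ⟨X, Y, a, p ≫ e.hom, fun M => ⟨?_, ?_⟩⟩
    · intro g
      rw [← (h M).1 g]
      exact map_eq_zero_iff (e.hom.app M).hom (app_injective_of_mono e.hom M)
    · exact (app_surjective_of_epi e.hom M).comp (h M).2

instance : (IsFP (A := A)).IsClosedUnderFiniteProducts := by
  have : (IsFP (A := A)).IsClosedUnderBinaryProducts := by
    refine ⟨?_⟩
    rintro P ⟨h⟩
    let F := h.diag.obj ⟨.left⟩
    let G := h.diag.obj ⟨.right⟩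
    have e : P ≅ F ⊞ G :=
      (h.isLimit.conePointUniqueUpToIso
        ((IsLimit.postcomposeInvEquiv (diagramIsoPair h.diag) _).symm (prodIsProd F G))) ≪≫
        (biprod.isoProd F G).symm
    exact (IsFP (A := A)).prop_of_iso e.symm (isFP_of_prod (h.prop_diag_obj _) (h.prop_diag_obj _)
      biprod.fst biprod.snd biprod.inl biprod.inr biprod.inl_fst biprod.inr_snd
      biprod.inl_snd biprod.inr_fst biprod.total)
  exact ObjectProperty.IsClosedUnderFiniteProducts.mk'

variable (A) in
/-- The category `fp(A, Ab)` of finitely presented functors, full in all functors `A ⥤ Ab`.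
It is closed under kernels, cokernels and finite products, so Mathlib makes it abelian. -/
abbrev FP := (IsFP (A := A)).FullSubcategory

lemma IsFP.additive {F : A ⥤ AddCommGrpCat.{v}} (hF : IsFP F) : F.Additive where
  map_add {M N} f g := by
    obtain ⟨X, Y, a, p, hp⟩ := (isFP_iff F).1 hF
    ext z
    obtain ⟨h, rfl⟩ := (hp M).2 z
    change F.map (f + g) (p.app M h) = F.map f (p.app M h) + F.map g (p.app M h)
    rw [← nat, ← nat, ← nat, Preadditive.comp_add]
    exact map_add (p.app N).hom _ _

variable (A) in
/-- The contravariant Yoneda embedding `X ↦ (X, -)`, as a functor `Aᵒᵖ ⥤ fp(A, Ab)`. -/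
def Yon : Aᵒᵖ ⥤ FP A := ObjectProperty.lift _ preadditiveCoyoneda fun X => isFP_rep X.unop

instance : (Yon A).Additive where
  map_add {X Y} f g := by
    ext M (h : X.unop ⟶ M)
    exact Preadditive.add_comp _ _ _ _ _ _

lemma FP.app_surjective {F G : FP A} (f : F ⟶ G) [Epi f] (M : A) :
    Function.Surjective (f.hom.app M) := by
  have := (IsFP (A := A)).preservesEpimorphisms_ι_of_isNormalMonoCategory
  have : Epi f.hom := inferInstanceAs (Epi ((IsFP (A := A)).ι.map f))
  exact app_surjective_of_epi f.hom M

instance (X : Aᵒᵖ) : Projective ((Yon A).obj X) where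
  factors {E F} f e _ := by
    obtain ⟨x, hx⟩ := FP.app_surjective e X.unop (f.hom.app X.unop (𝟙 X.unop))
    have hE := E.property.additive
    refine ⟨ObjectProperty.homMk
      { app := fun M => AddCommGrpCat.ofHom
          (AddMonoidHom.mk' (fun g : X.unop ⟶ M => E.obj.map g x) ?_)
        naturality := ?_ }, ?_⟩
    · intro (g : X.unop ⟶ M) (h : X.unop ⟶ M)
      exact ConcreteCategory.congr_hom (E.obj.map_add (f := g) (g := h)) x
    · intro M N h
      ext (g : X.unop ⟶ M)
      exact ConcreteCategory.congr_hom (E.obj.map_comp g h) x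
    · ext M (g : X.unop ⟶ M)
      change e.hom.app M (E.obj.map g x) = f.hom.app M g
      have h1 := ConcreteCategory.congr_hom (e.hom.naturality g) x
      have h2 := nat (p := (f.hom : Rep X.unop ⟶ F.obj)) (𝟙 _) g
      rw [Category.id_comp] at h2
      exact h1.trans ((congrArg (F.obj.map g) hx).trans h2.symm)

instance : EnoughProjectives (FP A) where
  presentation F := by
    obtain ⟨X, Y, a, p, hp⟩ := (isFP_iff F.obj).1 F.property
    have : Epi (ObjectProperty.homMk p : (Yon A).obj (op X) ⟶ F) :=
      (IsFP (A := A)).ι.epi_of_epi_map (epi_of_app_surjective p fun M => (hp M).2)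
    exact ⟨{ p := (Yon A).obj (op X), f := ObjectProperty.homMk p }⟩

instance : (Yon A).IsRightAdjoint := by
  have : ∀ F : FP A, HasInitial (StructuredArrow F (Yon A)) := by
    intro F
    obtain ⟨X, Y, a, p, hp⟩ := (isFP_iff F.obj).1 F.property
    let π : (Yon A).obj (op X) ⟶ F := ObjectProperty.homMk p
    have : Epi π := (IsFP (A := A)).ι.epi_of_epi_map (epi_of_app_surjective p fun M => (hp M).2)
    have hz : ∀ (M : A) (h : Y ⟶ M), p.app M (a ≫ h) = 0 := fun M h => ((hp M).1 _).2 ⟨h, rfl⟩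
    let S : ShortComplex (A ⥤ AddCommGrpCat.{v}) := .mk (preadditiveCoyoneda.map a.op) p (by
      ext M (h : Y ⟶ M); exact hz M h)
    have hS : S.Exact := exact_of_app fun M (g : X ⟶ M) => (hp M).1 g
    have : Epi S.g := epi_of_app_surjective p fun M => (hp M).2
    -- the map `F ⟶ (kernel a, -)`
    obtain ⟨r, hr⟩ : ∃ r : F.obj ⟶ Rep (kernel a),
        p ≫ r = preadditiveCoyoneda.map (kernel.ι a).op := by
      refine ⟨hS.desc (preadditiveCoyoneda.map (kernel.ι a).op) ?_, hS.g_desc _ _⟩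
      change preadditiveCoyoneda.map a.op ≫ _ = _
      rw [← Functor.map_comp, ← op_comp, kernel.condition, op_zero, Functor.map_zero]
    have key : ∀ (B : A) (f : F.obj ⟶ Rep B) (c : B ⟶ kernel a),
        r ≫ preadditiveCoyoneda.map c.op = f ↔
          preadditiveCoyoneda.map (c ≫ kernel.ι a).op = p ≫ f := by
      intro B f c
      rw [op_comp, Functor.map_comp, ← hr, Category.assoc]
      exact (cancel_epi S.g).symm
    have ex : ∀ (B : A) (f : F.obj ⟶ Rep B), ∃ c : B ⟶ kernel a,
        preadditiveCoyoneda.map (c ≫ kernel.ι a).op = p ≫ f := by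
      intro B f
      obtain ⟨b, hb⟩ := preadditiveCoyoneda.map_surjective (p ≫ f)
      have hab : a.op ≫ b = 0 := preadditiveCoyoneda.map_injective (by
        rw [Functor.map_comp, hb, Functor.map_zero]
        exact (S.zero_assoc f).trans zero_comp)
      exact ⟨kernel.lift a b.unop (congrArg Quiver.Hom.unop hab), by
        rw [kernel.lift_ι, Quiver.Hom.op_unop, hb]⟩
    have uniq : ∀ (B : A) (c d : B ⟶ kernel a), preadditiveCoyoneda.map (c ≫ kernel.ι a).op =
        preadditiveCoyoneda.map (d ≫ kernel.ι a).op → c = d := fun B c d h =>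
      (cancel_mono (kernel.ι a)).1 (Quiver.Hom.op_inj (preadditiveCoyoneda.map_injective h))
    let T : StructuredArrow F (Yon A) := StructuredArrow.mk (Y := op (kernel a))
      (ObjectProperty.homMk r : F ⟶ (Yon A).obj (op (kernel a)))
    refine IsInitial.hasInitial (X := T) (IsInitial.ofUniqueHom (fun V =>
      StructuredArrow.homMk (ex V.right.unop V.hom.hom).choose.op ?_) fun V m => ?_)
    · ext1
      exact (key _ _ _).2 (ex V.right.unop V.hom.hom).choose_spec
    · ext1
      refine Quiver.Hom.unop_inj (uniq _ m.right.unop _ ?_)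
      have h1 := (key V.right.unop V.hom.hom m.right.unop).1
        (congrArg InducedCategory.Hom.hom (StructuredArrow.w m))
      exact h1.trans (ex V.right.unop V.hom.hom).choose_spec.symm
  exact isRightAdjointOfStructuredArrowInitials _

variable (A) in
/-- Auslander's functor `w`, contravariant from `fp(A, Ab)` to `A`: the adjoint of the Yoneda
embedding. It sends `F` with presentation `(Y, -) ⟶ (X, -) ⟶ F ⟶ 0` to the kernel of `X ⟶ Y`. -/
def wFun : (FP A)ᵒᵖ ⥤ A := (Yon A).leftAdjoint.leftOp

instance : (wFun A).Additive := by
  have := (Adjunction.ofIsRightAdjoint (Yon A)).left_adjoint_additive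
  unfold wFun
  infer_instance

end FP

section Additive
variable (C : Type u) [Category.{v} C] [Preadditive C]

instance : (additiveFunctor C AddCommGrpCat.{w}).ContainsZero where
  exists_zero :=
    have h : IsZero (AddCommGrpCat.of PUnit.{w + 1}) := AddCommGrpCat.isZero_of_subsingleton _
    ⟨(Functor.const C).obj (AddCommGrpCat.of PUnit), by
      rw [IsZero.iff_id_eq_zero]
      ext1; ext1
      exact h.eq_of_src _ _, ⟨h.eq_of_src _ _⟩⟩

instance : (additiveFunctor C AddCommGrpCat.{w}).IsClosedUnderKernels where
  kernels_le := by
    rintro _ ⟨f, k, hk, hf⟩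
    have := Fork.IsLimit.mono hk
    have h := hf.1
    rw [additiveFunctor_iff] at h
    refine ⟨fun {X Y} a b => ?_⟩
    rw [← cancel_mono (k.ι.app Y), Preadditive.add_comp, k.ι.naturality, k.ι.naturality,
      k.ι.naturality]
    exact (congrArg (k.ι.app X ≫ ·) (Functor.map_add _)).trans (Preadditive.comp_add _ _ _ _ _ _)

instance : (additiveFunctor C AddCommGrpCat.{w}).IsClosedUnderCokernels where
  cokernels_le := by
    rintro _ ⟨f, k, hk, hf⟩
    have := Cofork.IsColimit.epi hk
    have h := hf.2
    rw [additiveFunctor_iff] at h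
    refine ⟨fun {X Y} a b => ?_⟩
    rw [← cancel_epi (k.π.app X), Preadditive.comp_add, ← k.π.naturality, ← k.π.naturality,
      ← k.π.naturality]
    exact (congrArg (· ≫ k.π.app Y) (Functor.map_add _)).trans (Preadditive.add_comp _ _ _ _ _ _)

instance : (additiveFunctor C AddCommGrpCat.{w}).IsClosedUnderFiniteProducts where
  isClosedUnderLimitsOfShape J _ := by
    refine ⟨?_⟩
    rintro F ⟨h⟩
    refine ⟨fun {X Y} a b => ?_⟩
    refine (isLimitOfPreserves ((evaluation C AddCommGrpCat.{w}).obj Y) h.isLimit).hom_ext fun j => ?_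
    have hj := h.prop_diag_obj j
    rw [additiveFunctor_iff] at hj
    change F.map (a + b) ≫ (h.π.app j).app Y = (F.map a + F.map b) ≫ (h.π.app j).app Y
    rw [Preadditive.add_comp]
    have e : ∀ c : X ⟶ Y, F.map c ≫ (h.π.app j).app Y =
      (h.π.app j).app X ≫ (h.diag.obj j).map c := fun c => (h.π.app j).naturality c
    rw [e, e, e, Functor.map_add, Preadditive.comp_add]

variable {C}

lemma additive_app_injective {F G : C ⥤+ AddCommGrpCat.{w}} (f : F ⟶ G) [Mono f] (M : C) :
    Function.Injective (f.hom.app M) := by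
  have := (additiveFunctor C AddCommGrpCat.{w}).preservesMonomorphisms_ι_of_isNormalEpiCategory
  have : Mono f.hom := inferInstanceAs (Mono ((additiveFunctor C AddCommGrpCat.{w}).ι.map f))
  exact app_injective_of_mono f.hom M

variable [EssentiallySmall.{v} C]

/-- The additive functor `K ↦ ∏ₛ Hom(Hom(K, s), I s)`. -/
def coind (I : SmallModel.{v} C → AddCommGrpCat.{v}) : C ⥤+ AddCommGrpCat.{v} where
  obj :=
    { obj := fun K => AddCommGrpCat.of
        (∀ s : SmallModel.{v} C, (K ⟶ (equivSmallModel C).inverse.obj s) →+ I s)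
      map := fun {K L} f => AddCommGrpCat.ofHom
        { toFun := fun φ s => (φ s).comp (Preadditive.leftComp _ f)
          map_zero' := rfl
          map_add' := fun _ _ => rfl }
      map_id := fun K => by
        ext φ s x
        exact congrArg (φ s) (Category.id_comp x)
      map_comp := fun f g => by
        ext φ s x
        exact congrArg (φ s) (Category.assoc f g x) }
  property := ⟨fun {K L f g} => by
    ext φ s x
    exact (congrArg (φ s) (Preadditive.add_comp _ _ _ f g x)).trans (map_add (φ s) _ _)⟩

/-- The map into `coind I` determined by a family of homomorphisms `F(s) ⟶ I s`. -/
def toCoind {I : SmallModel.{v} C → AddCommGrpCat.{v}} (F : C ⥤+ AddCommGrpCat.{v})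
    (h : ∀ s, F.obj.obj ((equivSmallModel C).inverse.obj s) ⟶ I s) : F ⟶ coind I :=
  ObjectProperty.homMk
    { app := fun K => AddCommGrpCat.ofHom (AddMonoidHom.mk' (fun x s =>
        AddMonoidHom.mk' (fun f => h s (F.obj.map f x)) fun f g => by
          rw [F.obj.map_add]; exact map_add (h s).hom _ _) fun x y => by
            funext s; ext f
            exact (congrArg (h s) (map_add (F.obj.map f).hom x y)).trans (map_add (h s).hom _ _))
      naturality := fun K L f => by
        ext x; funext s; ext g
        exact congrArg (h s) (ConcreteCategory.congr_hom (F.obj.map_comp f g) x).symm }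

instance (I : SmallModel.{v} C → AddCommGrpCat.{v}) [∀ s, Injective (I s)] :
    Injective (coind I) where
  factors {F G} g f _ := by
    have : ∀ s, Mono (f.hom.app ((equivSmallModel C).inverse.obj s)) := fun s =>
      (AddCommGrpCat.mono_iff_injective _).2 (additive_app_injective f _)
    let k : ∀ s, F.obj.obj ((equivSmallModel C).inverse.obj s) ⟶ I s := fun s =>
      AddCommGrpCat.ofHom (AddMonoidHom.mk' (fun x => g.hom.app _ x s (𝟙 _)) fun x y => by
        rw [map_add]; rfl)
    refine ⟨toCoind G fun s => Injective.factorThru (k s) (f.hom.app _), ?_⟩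
    ext K x; funext s; ext c
    change Injective.factorThru (k s) (f.hom.app _) (G.obj.map c (f.hom.app K x)) = g.hom.app K x s c
    have h1 : G.obj.map c (f.hom.app K x) = f.hom.app _ (F.obj.map c x) :=
      (ConcreteCategory.congr_hom (f.hom.naturality c) x).symm
    rw [h1]
    refine (ConcreteCategory.congr_hom (Injective.comp_factorThru (k s) (f.hom.app _)) _).trans ?_
    change g.hom.app _ (F.obj.map c x) s (𝟙 _) = _
    have h2 : g.hom.app _ (F.obj.map c x) = (coind I).obj.map c (g.hom.app K x) :=
      ConcreteCategory.congr_hom (g.hom.naturality c) x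
    rw [h2]
    exact congrArg (g.hom.app K x s) (Category.comp_id c)

instance : EnoughInjectives (C ⥤+ AddCommGrpCat.{v}) where
  presentation F := by
    let i := toCoind F fun s => Injective.ι (F.obj.obj ((equivSmallModel C).inverse.obj s))
    have : Mono i := by
      refine (additiveFunctor C AddCommGrpCat.{v}).ι.mono_of_mono_map
        (mono_of_app_injective i.hom fun K x y hxy => ?_)
      let c : K ≅ (equivSmallModel C).inverse.obj ((equivSmallModel C).functor.obj K) :=
        (equivSmallModel C).unitIso.app K
      have h1 : Injective.ι (F.obj.obj _) (F.obj.map c.hom x) =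
          Injective.ι (F.obj.obj _) (F.obj.map c.hom y) :=
        DFunLike.congr_fun (congrFun hxy ((equivSmallModel C).functor.obj K)) c.hom
      have h2 := (AddCommGrpCat.mono_iff_injective _).1
        (inferInstance : Mono (Injective.ι (F.obj.obj _))) h1
      exact (AddCommGrpCat.mono_iff_injective _).1
        (inferInstance : Mono (F.obj.map c.hom)) h2
    exact ⟨{ J := coind _, f := i }⟩

end Additive
section Modules
variable (R : Type u) [Ring R]

/-- The category `Mod(R)` of right `R`-modules. -/
abbrev RightMod := ModuleCat.{u} Rᵐᵒᵖ

/-- The category `mod(Rᵒᵖ)` of finitely presented left `R`-modules. -/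
abbrev FpLeftMod :=
  ObjectProperty.FullSubcategory fun L : ModuleCat.{u} R => Module.FinitePresentation R L

instance : EssentiallySmall.{u} (FpLeftMod R) :=
  have h : (fun L : ModuleCat.{u} R => Module.FinitePresentation R L) ≤ ModuleCat.isFG R :=
    fun L (_ : Module.FinitePresentation R L) => (inferInstance : Module.Finite R L)
  have : EssentiallySmall.{u} (ModuleCat.isFG.{u} R).FullSubcategory :=
    inferInstanceAs (EssentiallySmall.{u} (FGModuleCat.{u} R))
  have := ObjectProperty.full_ιOfLE h
  have := ObjectProperty.faithful_ιOfLE h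
  essentiallySmall_of_fully_faithful (ObjectProperty.ιOfLE h)

/-- The category `(mod(Rᵒᵖ), Ab)` of additive functors on finitely presented left modules. -/
abbrev AddFun := FpLeftMod R ⥤+ AddCommGrpCat.{u}

/-- The category `fp(Mod(R), Ab)`. -/
abbrev FpFun := FP (RightMod R)

variable {R}

/-- The relations `(x r) ⊗ l = x ⊗ (r l)` in `X ⊗_ℤ L`. -/
def tensorRel (X : RightMod R) (L : ModuleCat.{u} R) : AddSubgroup (TensorProduct ℤ X L) :=
  AddSubgroup.closure
    {z | ∃ (x : X) (r : R) (l : L), z = (MulOpposite.op r • x) ⊗ₜ[ℤ] l - x ⊗ₜ[ℤ] (r • l)}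

/-- The tensor product `X ⊗_R L` of a right module and a left module (an abelian group). -/
abbrev Tensor (X : RightMod R) (L : ModuleCat.{u} R) : Type u := TensorProduct ℤ X L ⧸ tensorRel X L

/-- The pure tensor `x ⊗ l` in `X ⊗_R L`. -/
def Tensor.mk {X : RightMod R} {L : ModuleCat.{u} R} (x : X) (l : L) : Tensor X L :=
  QuotientAddGroup.mk (x ⊗ₜ[ℤ] l)

lemma Tensor.hom_ext {X : RightMod R} {L : ModuleCat.{u} R} {B : Type*} [AddCommGroup B]
    {f g : Tensor X L →+ B} (h : ∀ x l, f (Tensor.mk x l) = g (Tensor.mk x l)) : f = g := by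
  refine QuotientAddGroup.addMonoidHom_ext _ ?_
  ext z
  induction z using TensorProduct.induction_on with
  | zero => simp
  | tmul x l => exact h x l
  | add y z hy hz => rw [map_add, map_add, hy, hz]

/-- The homomorphism `f ⊗ g`. -/
def Tensor.map {X X' : RightMod R} {L L' : ModuleCat.{u} R} (f : X ⟶ X') (g : L ⟶ L') :
    Tensor X L →+ Tensor X' L' :=
  QuotientAddGroup.map _ _
    (TensorProduct.map f.hom.toAddMonoidHom.toIntLinearMap
      g.hom.toAddMonoidHom.toIntLinearMap).toAddMonoidHom (by
    rw [tensorRel, AddSubgroup.closure_le]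
    rintro _ ⟨x, r, l, rfl⟩
    refine AddSubgroup.subset_closure ⟨f.hom x, r, g.hom l, ?_⟩
    simp [map_sub])

lemma Tensor.map_mk {X X' : RightMod R} {L L' : ModuleCat.{u} R} (f : X ⟶ X') (g : L ⟶ L')
    (x : X) (l : L) : Tensor.map f g (Tensor.mk x l) = Tensor.mk (f.hom x) (g.hom l) := rfl

lemma Tensor.mk_add {X : RightMod R} {L : ModuleCat.{u} R} (x : X) (l l' : L) :
    Tensor.mk x (l + l') = Tensor.mk x l + Tensor.mk x l' :=
  congrArg _ (TensorProduct.tmul_add x l l')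

lemma Tensor.add_mk {X : RightMod R} {L : ModuleCat.{u} R} (x x' : X) (l : L) :
    Tensor.mk (x + x') l = Tensor.mk x l + Tensor.mk x' l :=
  congrArg _ (TensorProduct.add_tmul x x' l)

lemma Tensor.smul_mk {X : RightMod R} {L : ModuleCat.{u} R} (x : X) (r : R) (l : L) :
    Tensor.mk (MulOpposite.op r • x) l = Tensor.mk x (r • l) :=
  (QuotientAddGroup.eq_iff_sub_mem).2 (AddSubgroup.subset_closure ⟨x, r, l, rfl⟩)

variable (R)

/-- The functor `t : Mod(R) ⥤ (mod(Rᵒᵖ), Ab)`, `t(X) = X ⊗ -`. -/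
def tensorEmb : RightMod R ⥤ AddFun R where
  obj X :=
    { obj :=
        { obj := fun L => AddCommGrpCat.of (Tensor X L.obj)
          map := fun g => AddCommGrpCat.ofHom (Tensor.map (𝟙 X) g.hom)
          map_id := fun L => by
            ext1; exact Tensor.hom_ext fun x l => rfl
          map_comp := fun f g => by
            ext1; exact Tensor.hom_ext fun x l => rfl }
      property := ⟨fun {K L f g} => by
        ext1; exact Tensor.hom_ext fun x l => Tensor.mk_add _ _ _⟩ }
  map f := ObjectProperty.homMk
    { app := fun L => AddCommGrpCat.ofHom (Tensor.map f (𝟙 L.obj))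
      naturality := fun K L g => by
        ext1; exact Tensor.hom_ext fun x l => rfl }
  map_id X := by
    ext L : 4; exact Tensor.hom_ext fun x l => rfl
  map_comp f g := by
    ext L : 4; exact Tensor.hom_ext fun x l => rfl

instance : (tensorEmb R).Additive where
  map_add {X Y f g} := by
    ext L : 4; exact Tensor.hom_ext fun x l => Tensor.add_mk _ _ _

/-- The ring `R` as a finitely presented left module over itself. -/
def leftReg : FpLeftMod R := ⟨ModuleCat.of R R, (inferInstance : Module.FinitePresentation R R)⟩

variable {R} in
/-- Right multiplication by an element of `R`, an endomorphism of the left module `R`. -/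
def rightMul (r : Rᵐᵒᵖ) : leftReg R ⟶ leftReg R :=
  ObjectProperty.homMk (ModuleCat.ofHom (LinearMap.toSpanSingleton R R r.unop))

variable {R} in
/-- The right `R`-module structure on `G(R)`: `r` acts as `G` of right multiplication by `r`. -/
abbrev evModule (G : AddFun R) : Module Rᵐᵒᵖ (G.obj.obj (leftReg R)) where
  smul r x := G.obj.map (rightMul r) x
  one_smul x := by
    have : rightMul (1 : Rᵐᵒᵖ) = 𝟙 (leftReg R) := by
      exact ObjectProperty.hom_ext _ (ModuleCat.hom_ext (LinearMap.ext fun (x : R) => mul_one x))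
    change G.obj.map (rightMul 1) x = x
    rw [this, G.obj.map_id]; rfl
  mul_smul r s x := by
    have : rightMul (r * s) = rightMul s ≫ rightMul r := by
      exact ObjectProperty.hom_ext _ (ModuleCat.hom_ext (LinearMap.ext fun (x : R) => (mul_assoc x _ _).symm))
    change G.obj.map (rightMul (r * s)) x = G.obj.map (rightMul r) (G.obj.map (rightMul s) x)
    rw [this, G.obj.map_comp]; rfl
  smul_zero r := map_zero (G.obj.map (rightMul r)).hom
  smul_add r := map_add (G.obj.map (rightMul r)).hom
  add_smul r s x := by
    have : rightMul (r + s) = rightMul r + rightMul s := by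
      exact ObjectProperty.hom_ext _ (ModuleCat.hom_ext (LinearMap.ext fun (x : R) => mul_add x _ _))
    change G.obj.map (rightMul (r + s)) x = G.obj.map (rightMul r) x + G.obj.map (rightMul s) x
    rw [this, G.obj.map_add]; rfl
  zero_smul x := by
    have : rightMul (0 : Rᵐᵒᵖ) = 0 := by
      exact ObjectProperty.hom_ext _ (ModuleCat.hom_ext (LinearMap.ext fun (x : R) => mul_zero x))
    change G.obj.map (rightMul 0) x = 0
    rw [this, G.obj.map_zero]; rfl

/-- Evaluation at the ring, `ev_R : (mod(Rᵒᵖ), Ab) ⥤ Mod(R)`, `G ↦ G(R)`. -/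
def evR : AddFun R ⥤ RightMod R where
  obj G :=
    letI := evModule G
    ModuleCat.of Rᵐᵒᵖ (G.obj.obj (leftReg R))
  map {G H} α :=
    letI := evModule G
    letI := evModule H
    ModuleCat.ofHom
      { toFun := α.hom.app (leftReg R)
        map_add' := map_add (α.hom.app (leftReg R)).hom
        map_smul' := fun r x => ConcreteCategory.congr_hom (α.hom.naturality (rightMul r)) x }

instance : (evR R).Additive where

/-- The Auslander-Gruson-Jensen functor `D_A`, contravariant from `fp(Mod(R), Ab)` to
`(mod(Rᵒᵖ), Ab)`: the zeroth right derived functor of the contravariant functor `t ∘ w`. Injective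
resolutions in `fp(Mod(R), Ab)ᵒᵖ` are projective resolutions in `fp(Mod(R), Ab)`. -/
def DA : (FpFun R)ᵒᵖ ⥤ AddFun R := (wFun (RightMod R) ⋙ tensorEmb R).rightDerived 0

/-- The functor `D_L`, contravariant from `(mod(Rᵒᵖ), Ab)` to `fp(Mod(R), Ab)`: the zeroth left
derived functor of the contravariant functor `G ↦ (G(R), -)`. Projective resolutions in
`(mod(Rᵒᵖ), Ab)ᵒᵖ` are injective resolutions in `(mod(Rᵒᵖ), Ab)`. -/
def DL : (AddFun R)ᵒᵖ ⥤ FpFun R := ((evR R).op ⋙ Yon (RightMod R)).leftDerived 0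

/-- Restriction of functors along an equivalence from a small model of `mod(Rᵒᵖ)`. It is fully
faithful; its only role is that groups of natural transformations between restricted functors are
abelian groups in the universe of `R`. -/
def resSmall : AddFun R ⥤ (SmallModel.{u} (FpLeftMod R) ⥤ AddCommGrpCat.{u}) :=
  AdditiveFunctor.forget _ _ ⋙
    (Functor.whiskeringLeft _ _ _).obj (equivSmallModel.{u} (FpLeftMod R)).inverse

/-- The functor `D_R` with values in all functors `Mod(R) ⥤ Ab`: `(D_R G)(M) = Nat(G, M ⊗ -)`. -/
def DRfun : (AddFun R)ᵒᵖ ⥤ RightMod R ⥤ AddCommGrpCat.{u} :=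
  (resSmall R).op ⋙ preadditiveCoyoneda ⋙
    (Functor.whiskeringLeft _ _ _).obj (tensorEmb R ⋙ resSmall R)

end Modules
section Recollement
variable {A : Type*} {B : Type*} {C : Type*} [Category* A] [Category* B] [Category* C]
  [Preadditive A] [Preadditive B] [Preadditive C]

/-- The preadditive category `A` is abelian. -/
def IsAbelianCat (A : Type*) [Category* A] [h : Preadditive A] : Prop :=
  ∃ ab : Abelian A, ab.toPreadditive = h

/-- A recollement `A ⥤ B ⥤ C` of abelian categories, with functors `i : A ⥤ B`, `f : B ⥤ C`,
left adjoints `iL`, `fL` and right adjoints `iR`, `fR`: the unit `𝟭 ⟶ f fL` and the counit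
`f fR ⟶ 𝟭` are isomorphisms, the counit `iL i ⟶ 𝟭` and the unit `𝟭 ⟶ iR i` are isomorphisms, and `i`
is an embedding onto the full subcategory of `B` of all objects `b` with `f b = 0`. -/
structure Recollement (i : A ⥤ B) (iL iR : B ⥤ A) (f : B ⥤ C) (fL fR : C ⥤ B) where
  abelian_left : IsAbelianCat A
  abelian_middle : IsAbelianCat B
  abelian_right : IsAbelianCat C
  additive_i : i.Additive
  additive_iL : iL.Additive
  additive_iR : iR.Additive
  additive_f : f.Additive
  additive_fL : fL.Additive
  additive_fR : fR.Additive
  adjfL : fL ⊣ f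
  adjfR : f ⊣ fR
  isIso_unit_fL : IsIso adjfL.unit
  isIso_counit_fR : IsIso adjfR.counit
  adjiL : iL ⊣ i
  adjiR : i ⊣ iR
  isIso_counit_iL : IsIso adjiL.counit
  isIso_unit_iR : IsIso adjiR.unit
  full_i : i.Full
  faithful_i : i.Faithful
  essImage_i : ∀ b : B, i.essImage b ↔ IsZero (f.obj b)

end Recollement

section AGJ
variable (R : Type u) [Ring R]

/-- The full subcategory `ker(D_A)` of `fp(Mod(R), Ab)`: all `F` with `D_A F = 0`. -/
def kerDA : ObjectProperty (FpFun R) := fun F => IsZero ((DA R).obj (op F))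

/-- The functor `D_R`, contravariant from `(mod(Rᵒᵖ), Ab)` to `fp(Mod(R), Ab)`, given that the
functors `D_R G = Nat(G, (?) ⊗ -)` are finitely presented. -/
def DR (hR : ∀ G, IsFP ((DRfun R).obj G)) : (AddFun R)ᵒᵖ ⥤ FpFun R :=
  ObjectProperty.lift _ (DRfun R) hR

/-- The functor `F ↦ F^p`, where `F^p` is the cokernel of `γ_F : D_L D_A F ⟶ F`. -/
def upperP (γ : (DA R).rightOp ⋙ DL R ⟶ 𝟭 (FpFun R))
    (hp : ∀ F, kerDA R ((cokernel γ).obj F)) : FpFun R ⥤ (kerDA R).FullSubcategory :=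
  ObjectProperty.lift _ (cokernel γ) hp

/-- The functor `F ↦ F_q`, where `F_q` is the kernel of `δ_F : F ⟶ D_R D_A F`. -/
def lowerQ {hR : ∀ G, IsFP ((DRfun R).obj G)} (δ : 𝟭 (FpFun R) ⟶ (DA R).rightOp ⋙ DR R hR)
    (hq : ∀ F, kerDA R ((kernel δ).obj F)) : FpFun R ⥤ (kerDA R).FullSubcategory :=
  ObjectProperty.lift _ (kernel δ) hq

variable {R}

/-- The representable functor `(X, -)` as an object of `fp(Mod(R), Ab)`. -/
abbrev yon (X : RightMod R) : FpFun R := (Yon (RightMod R)).obj (op X)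

/-- The canonical morphism `X ⊗ - ⟶ D_A(X, -)` (an isomorphism), the composite of
`t(X) ⟶ t(w(X, -))` and the map of `t ∘ w` to its zeroth right derived functor. -/
def tensorToDA (X : RightMod R) : (tensorEmb R).obj X ⟶ (DA R).obj (op (yon X)) :=
  (tensorEmb R).map ((Adjunction.ofIsRightAdjoint (Yon (RightMod R))).counit.app (op X)).unop ≫
    (wFun (RightMod R) ⋙ tensorEmb R).toRightDerivedZero.app (op (yon X))

/-- The canonical map `X ⟶ X ⊗ R = ev_R(X ⊗ -)`, `x ↦ x ⊗ 1` (an isomorphism). -/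
def toEvTensor (X : RightMod R) : X ⟶ (evR R).obj ((tensorEmb R).obj X) :=
  letI := evModule ((tensorEmb R).obj X)
  ModuleCat.ofHom
    { toFun := fun x => (Tensor.mk x (1 : R) : Tensor X (leftReg R).obj)
      map_add' := fun x y => Tensor.add_mk _ _ _
      map_smul' := fun r x => by
        refine (Tensor.smul_mk (L := (leftReg R).obj) x r.unop (1 : R)).trans ?_
        change (Tensor.mk x (r.unop * (1 : R)) : Tensor X (leftReg R).obj) =
          Tensor.mk x ((1 : R) * r.unop)
        rw [mul_one, one_mul] }

/-- The canonical map `D_L(X ⊗ -) ⟶ (X ⊗ R, -) ≅ (X, -)`. -/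
def DLtensorTo (X : RightMod R) : (DL R).obj (op ((tensorEmb R).obj X)) ⟶ yon X :=
  ((evR R).op ⋙ Yon (RightMod R)).fromLeftDerivedZero.app (op ((tensorEmb R).obj X)) ≫
    (Yon (RightMod R)).map (toEvTensor X).op

/-- The map `γ` on representable functors: `D_L D_A(X, -) ≅ D_L(X ⊗ -) ⟶ (X ⊗ R, -) ≅ (X, -)`. -/
def gammaRep (X : RightMod R) : (DL R).obj (op ((DA R).obj (op (yon X)))) ⟶ yon X :=
  (DL R).map (tensorToDA X).op ≫ DLtensorTo X

/-- The natural transformation `D_A(X, -) ⟶ X ⊗ -` corresponding, by Yoneda's lemma, to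
`δ_(X, -) : (X, -) ⟶ D_R D_A(X, -) = Nat(D_A(X, -), (?) ⊗ -)`. -/
def deltaRep {hR : ∀ G, IsFP ((DRfun R).obj G)}
    (δ : 𝟭 (FpFun R) ⟶ (DA R).rightOp ⋙ DR R hR) (X : RightMod R) :
    (resSmall R).obj ((DA R).obj (op (yon X))) ⟶ (resSmall R).obj ((tensorEmb R).obj X) :=
  (δ.app (yon X)).hom.app X (𝟙 X)

end AGJ
end AGJ
end

/-! Write `t ⊣ ev_R` for the tensor embedding and evaluation at `R`, with unit `X ≅ X ⊗ R` and
counit `G(R) ⊗ - ⟶ G`. Everything is computed on two classes of objects and then extended by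
exactness. On representables `D_A(X, -) ≅ X ⊗ -`, and on injective functors `D_L I ≅ (I(R), -)`,
because zeroth derived functors agree with the original functor there. For a general object, `D_A F`
is the kernel of `D_A P₀ ⟶ D_A P₁` for a projective presentation of `F`, and `D_L G` is the cokernel
of `D_L I₁ ⟶ D_L I₀` for an injective copresentation of `G`.

For `D_A ⊣ D_R`, an element of `F(M)` is a map `(M, -) ⟶ F`, so `g : G ⟶ D_A F` sends it to a map `G
⟶ D_A F ⟶ D_A(M, -) ≅ M ⊗ -`. This comparison `toDR` is bijective for representable `F` by Yoneda
and for all `F` by left exactness of both sides (`toDR_bijective`). It also shows that `D_A` turns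
right exact sequences into left exact ones. That `D_R G` is finitely presented holds because it is a
kernel of a map between products of functors `- ⊗ L` with `L` finitely presented (`isFP_DRfun`).

For `D_L ⊣ D_A`, the essential input is that an injective functor `I` satisfies `I ≅ I(R) ⊗ -`
(`tensorEvApp_bijective_of_injective`). Hence `D_A D_L I ≅ D_A(I(R), -) ≅ I(R) ⊗ - ≅ I`, and
applying `D_A` to a copresentation gives `D_A D_L G ≅ G` for all `G` (`isIso_DALto`). The chain
`Hom((I(R), -), (X, -)) = Hom(X, I(R)) = Hom(X ⊗ -, I)` gives the adjunction bijection for injective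
`I` and representable functors. Exactness first extends it to all `F`, then to all `G`
(`fromDA_bijective`).

The rest is formal: `D_A`, having both adjoints, is exact, so it kills the cokernel of `γ` and the
kernel of `δ`, and these represent maps to and from objects of `ker(D_A)`. -/

noncomputable section
namespace AGJ

/-! ### Zeroth derived functors: exactness on one resolution, and additivity. -/

section Derived
variable {C : Type*} [Category* C] {D : Type*} [Category* D] [Abelian C] [Abelian D]

section Left
variable [HasProjectiveResolutions C] (F : C ⥤ D) [F.Additive]

/-- The homology in degree 0 of `F P` is the cokernel of `F P₁ ⟶ F P₀`. The point is to identify its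
projection with the functorial map `L₀F(π)`, so that resolutions can be used without leaving the
functor `L₀F`. -/
lemma leftDerived_zero_map_π {X : C} (P : ProjectiveResolution X) (π : P.complex.X 0 ⟶ X)
    (hπ : π = P.π.f 0) :
    ∃ (Q : D) (p : F.obj (P.complex.X 0) ⟶ Q) (e : (F.leftDerived 0).obj X ≅ Q), Epi p ∧
      (∀ {Z : D} (z : F.obj (P.complex.X 0) ⟶ Z), F.map (P.complex.d 1 0) ≫ z = 0 →
        ∃ y : Q ⟶ Z, p ≫ y = z) ∧
      (F.leftDerived 0).map π ≫ e.hom = F.fromLeftDerivedZero.app (P.complex.X 0) ≫ p := by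
  -- Nothing leaves degree 0, so the identity of `P₀` is a chain map from `P₀` in degree 0 to the
  -- resolution; it lifts `π`.
  let φ : (ChainComplex.single₀ C).obj (P.complex.X 0) ⟶ P.complex :=
    (P.complex.fromSingle₀Equiv (P.complex.X 0)).symm (𝟙 _)
  have hφ : φ.f 0 = 𝟙 _ := by
    simp [φ]
  let S := ProjectiveResolution.self (P.complex.X 0)
  let K := (F.mapHomologicalComplex _).obj P.complex
  have h := ProjectiveResolution.isoLeftDerivedObj_hom_naturality π S P φ (by rw [hφ, hπ]; rfl) F 0
  refine ⟨K.opcycles 0, K.pOpcycles 0, P.isoLeftDerivedObj F 0 ≪≫ ChainComplex.isoHomologyι₀ K,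
    inferInstanceAs (Epi (K.pOpcycles 0)),
    fun z hz => ⟨K.descOpcycles z 1 (by simp) hz, K.p_descOpcycles z 1 (by simp) hz⟩, ?_⟩
  have h1 : (F.leftDerived 0).map π ≫ (P.isoLeftDerivedObj F 0).hom ≫
      (ChainComplex.isoHomologyι₀ K).hom = (S.isoLeftDerivedObj F 0).hom ≫
        HomologicalComplex.homologyMap ((F.mapHomologicalComplex _).map φ) 0 ≫
          K.homologyι 0 :=
    (Category.assoc _ _ _).symm.trans ((congrArg (· ≫ _) h).trans (Category.assoc _ _ _))
  refine h1.trans ((congrArg (_ ≫ ·) (HomologicalComplex.homologyι_naturality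
    ((F.mapHomologicalComplex _).map φ) 0)).trans ?_)
  rw [S.fromLeftDerivedZero_eq F]
  have h2 : HomologicalComplex.opcyclesMap ((F.mapHomologicalComplex _).map φ) 0 =
      S.fromLeftDerivedZero' F ≫ K.pOpcycles 0 := by
    refine (cancel_epi
      (((F.mapHomologicalComplex (ComplexShape.down ℕ)).obj S.complex).pOpcycles 0)).1 ?_
    refine (HomologicalComplex.p_opcyclesMap _ 0).trans ?_
    refine Eq.trans ?_ (S.pOpcycles_comp_fromLeftDerivedZero'_assoc F (K.pOpcycles 0)).symm
    exact congrArg (fun m => F.map m ≫ _) hφ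
  rw [h2]
  exact ((Category.assoc _ _ _).trans (congrArg (_ ≫ ·) (Category.assoc _ _ _))).symm

/-- The zeroth left derived functor is right exact on some projective presentation. -/
lemma exists_presentation_leftDerived_zero (X : C) :
    ∃ (P₁ P₀ : C) (d : P₁ ⟶ P₀) (π : P₀ ⟶ X) (w : d ≫ π = 0), Projective P₁ ∧ Projective P₀ ∧
      Epi π ∧ (ShortComplex.mk d π w).Exact ∧ Epi ((F.leftDerived 0).map π) ∧
      ∀ {Z : D} (z : (F.leftDerived 0).obj P₀ ⟶ Z), (F.leftDerived 0).map d ≫ z = 0 →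
        ∃ y : (F.leftDerived 0).obj X ⟶ Z, (F.leftDerived 0).map π ≫ y = z := by
  let P := projectiveResolution X
  let π : P.complex.X 0 ⟶ X := P.π.f 0
  have w : P.complex.d 1 0 ≫ π = 0 := P.complex_d_comp_π_f_zero
  obtain ⟨Q, p, e, hp, hd, h⟩ := leftDerived_zero_map_π F P π rfl
  have h' : (F.leftDerived 0).map π = F.fromLeftDerivedZero.app (P.complex.X 0) ≫ p ≫ e.inv := by
    rw [← Category.assoc, ← h, Category.assoc, e.hom_inv_id, Category.comp_id]
  refine ⟨_, _, P.complex.d 1 0, π, w, inferInstance, inferInstance,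
    inferInstanceAs (Epi (P.π.f 0)), P.exact₀, ?_, fun {Z} z hz => ?_⟩
  · rw [h']; infer_instance
  · obtain ⟨y, hy⟩ := hd (inv (F.fromLeftDerivedZero.app (P.complex.X 0)) ≫ z) (by
      rw [← cancel_epi (F.fromLeftDerivedZero.app (P.complex.X 1)), comp_zero, ← hz,
        ← F.fromLeftDerivedZero.naturality_assoc, IsIso.hom_inv_id_assoc])
    exact ⟨e.hom ≫ y, by simp [h', hy]⟩

lemma leftDerived_zero_map_add_of_projective {P X : C} [Projective P] [Projective X]
    (f g : P ⟶ X) : (F.leftDerived 0).map (f + g) =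
      (F.leftDerived 0).map f + (F.leftDerived 0).map g := by
  rw [← cancel_mono (F.fromLeftDerivedZero.app X)]
  simp only [Preadditive.add_comp, NatTrans.naturality, Functor.map_add, Preadditive.comp_add]

/-- On projectives `L₀F ≅ F` is additive. An arbitrary morphism lifts to projective covers, and
`L₀F` of the cover of the source is epi, so the identity can be checked on the lifts. -/
instance leftDerived_zero_additive : (F.leftDerived 0).Additive where
  map_add {X Y} f g := by
    obtain ⟨_, P, _, π, _, _, _, _, _, _, _⟩ := exists_presentation_leftDerived_zero F X
    obtain ⟨_, Q, _, ρ, _, _, _, _, _, _, _⟩ := exists_presentation_leftDerived_zero F Y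
    rw [← cancel_epi ((F.leftDerived 0).map π)]
    have h : ∀ k : X ⟶ Y, (F.leftDerived 0).map π ≫ (F.leftDerived 0).map k =
        (F.leftDerived 0).map (Projective.factorThru (π ≫ k) ρ) ≫ (F.leftDerived 0).map ρ := by
      intro k
      rw [← Functor.map_comp, ← Functor.map_comp, Projective.factorThru_comp]
    rw [Preadditive.comp_add, h f, h g, ← Preadditive.add_comp,
      ← leftDerived_zero_map_add_of_projective, ← Functor.map_comp, ← Functor.map_comp,
      Preadditive.add_comp, Projective.factorThru_comp, Projective.factorThru_comp,
      Preadditive.comp_add]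

end Left

section Right
variable [HasInjectiveResolutions C] (F : C ⥤ D) [F.Additive]

/-- Dual to `leftDerived_zero_map_π`: the cycles in degree 0 are the kernel of `F I⁰ ⟶ F I¹`, and
their inclusion is identified with `R⁰F(ι)`. -/
lemma rightDerived_zero_map_ι {X : C} (I : InjectiveResolution X) (ι : X ⟶ I.cocomplex.X 0)
    (hι : ι = I.ι.f 0) :
    ∃ (Q : D) (q : Q ⟶ F.obj (I.cocomplex.X 0)) (e : Q ≅ (F.rightDerived 0).obj X), Mono q ∧
      (∀ {Z : D} (z : Z ⟶ F.obj (I.cocomplex.X 0)), z ≫ F.map (I.cocomplex.d 0 1) = 0 →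
        ∃ y : Z ⟶ Q, y ≫ q = z) ∧
      e.hom ≫ (F.rightDerived 0).map ι = q ≫ F.toRightDerivedZero.app (I.cocomplex.X 0) := by
  let φ : I.cocomplex ⟶ (CochainComplex.single₀ C).obj (I.cocomplex.X 0) :=
    (I.cocomplex.toSingle₀Equiv (I.cocomplex.X 0)).symm (𝟙 _)
  have hφ : φ.f 0 = 𝟙 _ := by
    simp [φ]
  let S := InjectiveResolution.self (I.cocomplex.X 0)
  let K := (F.mapHomologicalComplex _).obj I.cocomplex
  have h := InjectiveResolution.isoRightDerivedObj_inv_naturality ι I S φ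
    (by rw [hφ, hι]; rfl) F 0
  refine ⟨K.cycles 0, K.iCycles 0,
    CochainComplex.isoHomologyπ₀ K ≪≫ (I.isoRightDerivedObj F 0).symm,
    inferInstanceAs (Mono (K.iCycles 0)),
    fun z hz => ⟨K.liftCycles z 1 (by simp) hz, K.liftCycles_i z 1 (by simp) hz⟩, ?_⟩
  have h1 : ((CochainComplex.isoHomologyπ₀ K).hom ≫ (I.isoRightDerivedObj F 0).inv) ≫
      (F.rightDerived 0).map ι = (K.homologyπ 0 ≫
        HomologicalComplex.homologyMap ((F.mapHomologicalComplex _).map φ) 0) ≫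
          (S.isoRightDerivedObj F 0).inv :=
    (Category.assoc _ _ _).trans ((congrArg (_ ≫ ·) h).trans (Category.assoc _ _ _).symm)
  refine h1.trans ((congrArg (· ≫ _) (HomologicalComplex.homologyπ_naturality
    ((F.mapHomologicalComplex _).map φ) 0)).trans ?_)
  rw [S.toRightDerivedZero_eq F]
  have h2 : HomologicalComplex.cyclesMap ((F.mapHomologicalComplex _).map φ) 0 =
      K.iCycles 0 ≫ S.toRightDerivedZero' F := by
    refine (cancel_mono
      (((F.mapHomologicalComplex (ComplexShape.up ℕ)).obj S.cocomplex).iCycles 0)).1 ?_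
    refine (HomologicalComplex.cyclesMap_i _ 0).trans ?_
    refine Eq.trans ?_ (Category.assoc _ _ _).symm
    refine congrArg (_ ≫ ·) (Eq.trans ?_ (S.toRightDerivedZero'_comp_iCycles F).symm)
    exact congrArg F.map hφ
  rw [h2]
  exact (Category.assoc _ _ _).trans (Category.assoc _ _ _)

/-- The zeroth right derived functor is left exact on some injective copresentation. -/
lemma exists_copresentation_rightDerived_zero (X : C) :
    ∃ (I₀ I₁ : C) (ι : X ⟶ I₀) (d : I₀ ⟶ I₁) (w : ι ≫ d = 0), Injective I₀ ∧ Injective I₁ ∧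
      Mono ι ∧ (ShortComplex.mk ι d w).Exact ∧ Mono ((F.rightDerived 0).map ι) ∧
      ∀ {Z : D} (z : Z ⟶ (F.rightDerived 0).obj I₀), z ≫ (F.rightDerived 0).map d = 0 →
        ∃ y : Z ⟶ (F.rightDerived 0).obj X, y ≫ (F.rightDerived 0).map ι = z := by
  let I := injectiveResolution X
  let ι : X ⟶ I.cocomplex.X 0 := I.ι.f 0
  have w : ι ≫ I.cocomplex.d 0 1 = 0 := I.ι_f_zero_comp_complex_d
  obtain ⟨Q, q, e, hq, hd, h⟩ := rightDerived_zero_map_ι F I ι rfl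
  have h' : (F.rightDerived 0).map ι = e.inv ≫ q ≫ F.toRightDerivedZero.app (I.cocomplex.X 0) := by
    rw [← h, e.inv_hom_id_assoc]
  refine ⟨_, _, ι, I.cocomplex.d 0 1, w, inferInstance, inferInstance,
    inferInstanceAs (Mono (I.ι.f 0)), I.exact₀, ?_, fun {Z} z hz => ?_⟩
  · rw [h']; infer_instance
  · obtain ⟨y, hy⟩ := hd (z ≫ inv (F.toRightDerivedZero.app (I.cocomplex.X 0))) (by
      rw [← cancel_mono (F.toRightDerivedZero.app (I.cocomplex.X 1)), zero_comp, ← hz,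
        Category.assoc, Category.assoc, F.toRightDerivedZero.naturality,
        IsIso.inv_hom_id_assoc])
    exact ⟨y ≫ e.hom, by simp [h', reassoc_of% hy]⟩

lemma rightDerived_zero_map_add_of_injective {X I : C} [Injective X] [Injective I]
    (f g : X ⟶ I) : (F.rightDerived 0).map (f + g) =
      (F.rightDerived 0).map f + (F.rightDerived 0).map g := by
  rw [← cancel_epi (F.toRightDerivedZero.app X)]
  simp only [Preadditive.comp_add, ← NatTrans.naturality, Functor.map_add, Preadditive.add_comp]

instance rightDerived_zero_additive : (F.rightDerived 0).Additive where
  map_add {X Y} f g := by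
    obtain ⟨I, _, i, _, _, _, _, _, _, _, _⟩ := exists_copresentation_rightDerived_zero F X
    obtain ⟨J, _, j, _, _, _, _, _, _, _, _⟩ := exists_copresentation_rightDerived_zero F Y
    rw [← cancel_mono ((F.rightDerived 0).map j)]
    have h : ∀ k : X ⟶ Y, (F.rightDerived 0).map k ≫ (F.rightDerived 0).map j =
        (F.rightDerived 0).map i ≫ (F.rightDerived 0).map (Injective.factorThru (k ≫ j) i) := by
      intro k
      rw [← Functor.map_comp, ← Functor.map_comp, Injective.comp_factorThru]
    rw [Preadditive.add_comp, h f, h g, ← Preadditive.comp_add,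
      ← rightDerived_zero_map_add_of_injective, ← Functor.map_comp, ← Functor.map_comp,
      Preadditive.comp_add, Injective.comp_factorThru, Injective.comp_factorThru,
      Preadditive.add_comp]

end Right

end Derived

/-! ### Products of finitely presented functors. -/

section Products
variable {A : Type u} [Category.{v} A] [Abelian A]

/-- The pointwise product of a family of functors to abelian groups. -/
def prodFun {I : Type v} (F : I → A ⥤ AddCommGrpCat.{v}) : A ⥤ AddCommGrpCat.{v} where
  obj M := AddCommGrpCat.of (∀ i, (F i).obj M)
  map f := AddCommGrpCat.ofHom
    { toFun := fun x i => (F i).map f (x i)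
      map_zero' := by funext i; exact map_zero ((F i).map f).hom
      map_add' := fun x y => by funext i; exact map_add ((F i).map f).hom _ _ }
  map_id M := by
    ext x i; exact ConcreteCategory.congr_hom ((F i).map_id M) (x i)
  map_comp f g := by
    ext x i; exact ConcreteCategory.congr_hom ((F i).map_comp f g) (x i)

/-- Products of abelian groups are exact and `∏ (X i, -) = (∐ X, -)`, so the product of
presentations is a presentation. -/
lemma isFP_prodFun [HasCoproducts.{v} A] {I : Type v} {F : I → A ⥤ AddCommGrpCat.{v}}
    (hF : ∀ i, IsFP (F i)) : IsFP (prodFun F) := by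
  simp only [isFP_iff] at hF ⊢
  choose X Y a p hp using hF
  refine ⟨∐ X, ∐ Y, Limits.Sigma.map a,
    { app := fun M => AddCommGrpCat.ofHom
        (AddMonoidHom.mk' (fun (g : ∐ X ⟶ M) i => (p i).app M (Sigma.ι X i ≫ g)) ?_)
      naturality := ?_ }, fun M => ⟨fun g => ?_, fun z => ?_⟩⟩
  · intro g h
    funext i
    refine (congrArg ((p i).app M) (Preadditive.comp_add _ _ _ (Sigma.ι X i) g h)).trans ?_
    exact map_add ((p i).app M).hom _ _
  · intro M N f
    ext (g : ∐ X ⟶ M)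
    funext i
    change (p i).app N (Sigma.ι X i ≫ g ≫ f) = (F i).map f ((p i).app M (Sigma.ι X i ≫ g))
    rw [← nat, Category.assoc]
  · constructor
    · intro h
      have h1 : ∀ i, ∃ k : Y i ⟶ M, a i ≫ k = Sigma.ι X i ≫ g := fun i =>
        ((hp i M).1 _).1 (congrFun h i)
      choose k hk using h1
      exact ⟨Sigma.desc k, by ext i; simp [hk]⟩
    · rintro ⟨k, rfl⟩
      funext i
      exact ((hp i M).1 _).2 ⟨Sigma.ι Y i ≫ k, by simp⟩
  · choose g hg using fun i => (hp i M).2 (z i)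
    refine ⟨Sigma.desc g, ?_⟩
    funext i
    change (p i).app M (Sigma.ι X i ≫ Sigma.desc g) = z i
    rw [Sigma.ι_desc, hg]

end Products

/-! ### Finite presentation of `- ⊗ L` and of `D_R G`. -/

section Tensor
variable {R : Type u} [Ring R]

/-- The homomorphism on `X ⊗ L` induced by a balanced biadditive map. -/
def Tensor.lift {X : RightMod R} {L : ModuleCat.{u} R} {B : Type*} [AddCommGroup B]
    (φ : X →+ L →+ B) (hφ : ∀ (r : R) x l, φ (MulOpposite.op r • x) l = φ x (r • l)) :
    Tensor X L →+ B :=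
  QuotientAddGroup.lift _ (TensorProduct.liftAddHom φ fun r x l => by simp) (by
    rw [tensorRel, AddSubgroup.closure_le]
    rintro _ ⟨x, r, l, rfl⟩
    change TensorProduct.liftAddHom φ _ _ = 0
    rw [map_sub, sub_eq_zero]
    exact hφ r x l)

/-- The homomorphism `x ↦ x ⊗ l`. -/
def Tensor.mkLeft (X : RightMod R) {L : ModuleCat.{u} R} (l : L) : X →+ Tensor X L :=
  AddMonoidHom.mk' (fun x => Tensor.mk x l) fun x y => Tensor.add_mk x y l

/-- The homomorphism `l ↦ x ⊗ l`. -/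
def Tensor.mkRight {X : RightMod R} (L : ModuleCat.{u} R) (x : X) : L →+ Tensor X L :=
  AddMonoidHom.mk' (fun l => Tensor.mk x l) fun l l' => Tensor.mk_add x l l'

lemma Tensor.induction_on {X : RightMod R} {L : ModuleCat.{u} R} {P : Tensor X L → Prop}
    (z : Tensor X L) (zero : P 0) (mk : ∀ x l, P (Tensor.mk x l))
    (add : ∀ y z, P y → P z → P (y + z)) : P z := by
  obtain ⟨z, rfl⟩ := QuotientAddGroup.mk_surjective z
  induction z using TensorProduct.induction_on with
  | zero => exact zero
  | tmul x l => exact mk x l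
  | add y z hy hz => exact add _ _ hy hz

variable (R) in
/-- The functor `X ↦ X ⊗ L`. -/
def tensorAt (L : FpLeftMod R) : RightMod R ⥤ AddCommGrpCat.{u} :=
  tensorEmb R ⋙ AdditiveFunctor.forget _ _ ⋙ (evaluation _ _).obj L

/-- Right exactness of the tensor product, for a presentation of the left module by finite free
modules. -/
lemma exists_of_sum_mk_eq_zero {L : ModuleCat.{u} R} {m n : ℕ}
    (f : (Fin m → R) →ₗ[R] (Fin n → R)) (q : (Fin n → R) →ₗ[R] L)
    (hq : Function.Surjective q) (hfq : Function.Exact f q) (M : RightMod R) (g : Fin n → M)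
    (hg : ∑ k, Tensor.mk (g k) (q (Pi.single k 1)) = (0 : Tensor M L)) :
    ∃ w : Fin m → M, ∀ k, g k = ∑ j, MulOpposite.op (f (Pi.single j 1) k) • w j := by
  -- `W` is `M ⊗ f : M^m ⟶ M^n` in coordinates, and the goal is that `g` lies in its range. The
  -- proof maps `M ⊗ L` to `M^n / range W` by sending `x ⊗ q(v)` to the class of `(x vₖ)ₖ`; the
  -- image of the given vanishing sum is the class of `g`.
  let W : (Fin m → M) →+ (Fin n → M) := AddMonoidHom.mk'
    (fun w k => ∑ j, MulOpposite.op (f (Pi.single j 1) k) • w j) fun w w' => by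
      funext k
      simp [smul_add, Finset.sum_add_distrib]
  let V : M →+ (Fin n → R) →+ (Fin n → M) := AddMonoidHom.mk' (fun x => AddMonoidHom.mk'
    (fun v k => MulOpposite.op (v k) • x) fun v v' => by
      funext k
      simp [add_smul]) fun x y => by
        ext v k
        simp
  -- Two lifts of the same element of `L` differ by some `f c`, and `V x (f c) = W (x c)`, so the
  -- class does not depend on the lift.
  have hV : ∀ x v v', q v = q v' →
      (QuotientAddGroup.mk (V x v) : (Fin n → M) ⧸ W.range) = QuotientAddGroup.mk (V x v') := by
    intro x v v' h
    rw [QuotientAddGroup.eq_iff_sub_mem, ← map_sub]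
    obtain ⟨c, hc⟩ := (hfq (v - v')).1 (by rw [map_sub, h, sub_self])
    refine ⟨fun j => MulOpposite.op (c j) • x, ?_⟩
    funext k
    change ∑ j, MulOpposite.op (f (Pi.single j 1) k) • MulOpposite.op (c j) • x =
      MulOpposite.op ((v - v') k) • x
    have h1 : f c = ∑ j, c j • f (Pi.single j 1) := by
      conv_lhs => rw [← (Pi.basisFun R (Fin m)).sum_repr c]
      simp
    rw [← hc, h1]
    simp [Finset.sum_smul, mul_smul]
  let σ := Function.surjInv hq
  have hσ : ∀ l, q (σ l) = l := Function.surjInv_eq hq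
  let φ : M →+ L →+ (Fin n → M) ⧸ W.range := AddMonoidHom.mk' (fun x => AddMonoidHom.mk'
    (fun l => QuotientAddGroup.mk (V x (σ l))) fun l l' => by
      rw [← QuotientAddGroup.mk_add, ← map_add]
      exact hV _ _ _ (by rw [map_add, hσ, hσ, hσ])) fun x y => by
        ext l
        change QuotientAddGroup.mk (V (x + y) (σ l)) = _
        rw [map_add]
        rfl
  have hφ : ∀ (r : R) x l, φ (MulOpposite.op r • x) l = φ x (r • l) := by
    intro r x l
    refine Eq.trans ?_ (hV x (r • σ l) (σ (r • l)) (by rw [map_smul, hσ, hσ]))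
    change QuotientAddGroup.mk _ = _
    congr 1
    funext k
    change MulOpposite.op (σ l k) • MulOpposite.op r • x = MulOpposite.op (r * σ l k) • x
    rw [← mul_smul, ← MulOpposite.op_mul]
  have h := congrArg (Tensor.lift φ hφ) hg
  rw [map_sum, map_zero] at h
  have h2 : ∀ k, Tensor.lift φ hφ (Tensor.mk (g k) (q (Pi.single k 1))) =
      QuotientAddGroup.mk' W.range (V (g k) (Pi.single k 1)) := fun k => hV _ _ _ (hσ _)
  simp only [h2] at h
  rw [← map_sum, ← AddMonoidHom.mem_ker, QuotientAddGroup.ker_mk'] at h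
  obtain ⟨w, hw⟩ := h
  refine ⟨w, fun k => (Eq.trans ?_ (congrFun hw k).symm)⟩
  rw [Finset.sum_apply]
  change _ = ∑ j, MulOpposite.op ((Pi.single j 1 : Fin n → R) k) • g j
  rw [Finset.sum_eq_single k]
  · simp
  · intro j _ hj
    simp [Pi.single_eq_of_ne hj.symm]
  · simp

variable (R) in
/-- The free right module of rank `n`. -/
abbrev freeRight (n : ℕ) : RightMod R := ModuleCat.of Rᵐᵒᵖ (Fin n → Rᵐᵒᵖ)

/-- The standard basis of a free right module. -/
def freeRightBasis {n : ℕ} (k : Fin n) : freeRight R n := (Pi.single k 1 : Fin n → Rᵐᵒᵖ)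

/-- The morphism from a free right module with prescribed values on the basis. -/
def freeRightDesc {n : ℕ} {M : RightMod R} (x : Fin n → M) : freeRight R n ⟶ M :=
  ModuleCat.ofHom ((Pi.basisFun Rᵐᵒᵖ (Fin n)).constr ℕ x)

lemma freeRightDesc_basis {n : ℕ} {M : RightMod R} (x : Fin n → M) (k : Fin n) :
    (freeRightDesc x).hom (freeRightBasis k) = x k := by
  have := (Pi.basisFun Rᵐᵒᵖ (Fin n)).constr_basis ℕ x k
  rwa [Pi.basisFun_apply] at this

lemma freeRight_apply {n : ℕ} {M : RightMod R} (g : freeRight R n ⟶ M) (c : Fin n → Rᵐᵒᵖ) :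
    g.hom c = ∑ k, c k • g.hom (freeRightBasis k) := by
  conv_lhs => rw [← (Pi.basisFun Rᵐᵒᵖ (Fin n)).sum_repr c]
  rw [map_sum]
  simp [freeRightBasis]

lemma freeRight_hom_ext {n : ℕ} {M : RightMod R} {g h : freeRight R n ⟶ M}
    (e : ∀ k, g.hom (freeRightBasis k) = h.hom (freeRightBasis k)) : g = h := by
  ext1
  exact (Pi.basisFun Rᵐᵒᵖ (Fin n)).ext fun k => by
    rw [Pi.basisFun_apply]
    exact e k

/-- `X ↦ X ⊗ L` is finitely presented if `L` is. -/
lemma isFP_tensorAt (L : FpLeftMod R) : IsFP (tensorAt R L) := by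
  have := L.property
  obtain ⟨n, m, q, f, hq, hfq⟩ := Module.FinitePresentation.exists_fin' R L.obj
  rw [isFP_iff]
  -- The transpose of `f`. Since `M ⊗ R^n ≅ M^n ≅ (R^n, M)`, tensoring `R^m ⟶ R^n ⟶ L ⟶ 0` with `M`
  -- gives a presentation of `- ⊗ L` by representables with this `a`.
  let a : freeRight R n ⟶ freeRight R m :=
    freeRightDesc fun k j => MulOpposite.op (f (Pi.single j 1) k)
  have ha : ∀ k, a.hom (freeRightBasis k) = fun j => MulOpposite.op (f (Pi.single j 1) k) :=
    freeRightDesc_basis _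
  let p (M : RightMod R) (g : freeRight R n ⟶ M) : Tensor M L.obj :=
    ∑ k, Tensor.mk (g.hom (freeRightBasis k)) (q (Pi.single k 1))
  refine ⟨_, _, a,
    { app := fun M => AddCommGrpCat.ofHom (AddMonoidHom.mk' (p M) ?_)
      naturality := ?_ }, fun M => ⟨fun g => ?_, fun z => ?_⟩⟩
  · intro g h
    change ∑ k, Tensor.mk (g.hom (freeRightBasis k) + h.hom (freeRightBasis k)) _ = _
    simp only [Tensor.add_mk, Finset.sum_add_distrib]
    rfl
  · intro M N h
    ext (g : freeRight R n ⟶ M)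
    change p N (g ≫ h) = Tensor.map h (𝟙 L.obj) (p M g)
    simp only [p, map_sum, Tensor.map_mk]
    rfl
  · constructor
    · intro h
      obtain ⟨w, hw⟩ := exists_of_sum_mk_eq_zero f q hq hfq M _ h
      refine ⟨freeRightDesc w, freeRight_hom_ext fun k => ?_⟩
      change (freeRightDesc w).hom (a.hom (freeRightBasis k)) = _
      rw [ha, freeRight_apply, hw]
      exact Finset.sum_congr rfl fun j _ => congrArg (_ • ·) (freeRightDesc_basis w j)
    · rintro ⟨h, rfl⟩
      change p M (a ≫ h) = 0
      have h1 : ∀ k, (a ≫ h).hom (freeRightBasis k) =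
          ∑ j, MulOpposite.op (f (Pi.single j 1) k) • h.hom (freeRightBasis j) := by
        intro k
        change h.hom (a.hom (freeRightBasis k)) = _
        rw [ha, freeRight_apply]
      have h2 : ∀ k, Tensor.mk ((a ≫ h).hom (freeRightBasis k)) (q (Pi.single k 1)) =
          ∑ j, Tensor.mk (h.hom (freeRightBasis j)) (f (Pi.single j 1) k • q (Pi.single k 1)) := by
        intro k
        rw [h1]
        refine (map_sum (Tensor.mkLeft M (q (Pi.single k 1))) _ _).trans ?_
        exact Finset.sum_congr rfl fun j _ => Tensor.smul_mk _ _ _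
      simp only [p, h2]
      rw [Finset.sum_comm]
      refine Finset.sum_eq_zero fun j _ => ?_
      refine (map_sum (Tensor.mkRight L.obj (h.hom (freeRightBasis j))) _ _).symm.trans ?_
      have h3 : ∑ k, f (Pi.single j 1) k • q (Pi.single k 1) = q (f (Pi.single j 1)) := by
        conv_rhs => rw [← (Pi.basisFun R (Fin n)).sum_repr (f (Pi.single j 1))]
        simp
      rw [h3, hfq.apply_apply_eq_zero, map_zero]
  · change ∃ g, p M g = z
    refine Tensor.induction_on (P := fun z => ∃ g, p M g = z) z
      ⟨0, Finset.sum_eq_zero fun k _ => map_zero (Tensor.mkLeft M _)⟩ ?_ ?_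
    · intro x l
      obtain ⟨v, rfl⟩ := hq l
      refine ⟨freeRightDesc fun k => MulOpposite.op (v k) • x, ?_⟩
      refine (Finset.sum_congr rfl fun k _ => ((congrArg (fun y => Tensor.mk y _)
        (freeRightDesc_basis (M := M) (fun k => MulOpposite.op (v k) • x) k)).trans
          (Tensor.smul_mk x (v k) _))).trans ?_
      refine (map_sum (Tensor.mkRight L.obj x) _ _).symm.trans ?_
      have h3 : ∑ k, v k • q (Pi.single k 1) = q v := by
        conv_rhs => rw [← (Pi.basisFun R (Fin n)).sum_repr v]
        simp
      rw [h3]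
      rfl
    · rintro _ _ ⟨g, rfl⟩ ⟨h, rfl⟩
      refine ⟨g + h, ?_⟩
      change ∑ k, Tensor.mk (g.hom (freeRightBasis k) + h.hom (freeRightBasis k)) _ = _
      simp only [Tensor.add_mk, Finset.sum_add_distrib]
      rfl

/-- The functors `Nat(G, (?) ⊗ -)` are finitely presented. -/
theorem isFP_DRfun (G : (AddFun R)ᵒᵖ) : IsFP ((DRfun R).obj G) := by
  let E := (equivSmallModel.{u} (FpLeftMod R)).inverse
  let G' := E ⋙ G.unop.obj
  let I := Σ s, G'.obj s
  -- A family `x` indexed by the elements of `G` is a natural transformation by homomorphisms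
  -- exactly when `c(x_g) + x_h = x_{c(g) + h}` for all `c : s ⟶ s'`, `g`, `h`. This one family of
  -- equations presents `Nat(G, (?) ⊗ -)` as the kernel of `f`. The small model keeps both index
  -- sets in the right universe.
  let J := Σ (s s' : SmallModel.{u} (FpLeftMod R)), (s ⟶ s') × G'.obj s × G'.obj s'
  let T (s : SmallModel.{u} (FpLeftMod R)) := tensorAt R (E.obj s)
  let τ {s s' : SmallModel.{u} (FpLeftMod R)} (c : s ⟶ s') : T s ⟶ T s' :=
    Functor.whiskerLeft _ (Functor.whiskerLeft _ ((evaluation _ _).map (E.map c)))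
  let d (M : RightMod R) (x : ∀ s, G'.obj s → (T s).obj M) (j : J) : (T j.2.1).obj M :=
    (τ j.2.2.1).app M (x j.1 j.2.2.2.1) + x j.2.1 j.2.2.2.2 -
      x j.2.1 (G'.map j.2.2.1 j.2.2.2.1 + j.2.2.2.2)
  let f : prodFun (fun i : I => T i.1) ⟶ prodFun fun j : J => T j.2.1 :=
    { app := fun M => AddCommGrpCat.ofHom (AddMonoidHom.mk' (fun x => d M fun s g => x ⟨s, g⟩)
        fun x y => by
          funext j
          refine (congrArg (· + _ - _) (map_add ((τ j.2.2.1).app M).hom _ _)).trans ?_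
          refine (congrArg (· - _) (add_add_add_comm _ _ _ _)).trans ?_
          exact add_sub_add_comm _ _ _ _)
      naturality := fun M N α => by
        ext x
        funext j
        refine Eq.trans ?_ (map_sub ((T j.2.1).map α).hom _ _).symm
        refine congrArg (· - _) (Eq.trans ?_ (map_add ((T j.2.1).map α).hom _ _).symm)
        exact congrArg (· + _) (ConcreteCategory.congr_hom ((τ j.2.2.1).naturality α) _) }
  let k : (DRfun R).obj G ⟶ prodFun fun i : I => T i.1 :=
    { app := fun M => AddCommGrpCat.ofHom (AddMonoidHom.mk'
        (fun (η : (resSmall R).obj G.unop ⟶ (resSmall R).obj ((tensorEmb R).obj M)) (i : I) =>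
          (η.app i.1 i.2 : (T i.1).obj M)) fun η θ => rfl)
      naturality := fun M N α => rfl }
  refine isFP_of_exact_kernel (isFP_prodFun fun i : I => isFP_tensorAt _)
    (isFP_prodFun fun j : J => isFP_tensorAt _) k f ?_ ?_
  · intro M η θ h
    refine NatTrans.ext (funext fun s => ?_)
    ext g
    exact congrFun h ⟨s, g⟩
  · intro M x
    let y : ∀ s, G'.obj s → (T s).obj M := fun s g => x ⟨s, g⟩
    constructor
    · intro hx
      have h1 : ∀ {s s'} (c : s ⟶ s') g h, (τ c).app M (y s g) + y s' h = y s' (G'.map c g + h) :=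
        fun {s s'} c g h => sub_eq_zero.1 (congrFun hx ⟨s, s', c, g, h⟩)
      -- Additivity is the case where `c` is an identity; it gives `y s 0 = 0`, after which `h = 0`
      -- gives naturality.
      have h2 : ∀ s g h, y s (g + h) = y s g + y s h := by
        intro s g h
        have h3 := (h1 (𝟙 s) g h).symm
        have h4 : (τ (𝟙 s)).app M = 𝟙 _ := (congrArg ((tensorEmb R).obj M).obj.map
          (E.map_id s)).trans (CategoryTheory.Functor.map_id _ _)
        rwa [G'.map_id, h4] at h3
      have h3 : ∀ s, y s 0 = 0 := fun s => map_zero (AddMonoidHom.mk' (y s) (h2 s))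
      refine ⟨({ app := fun s => AddCommGrpCat.ofHom (AddMonoidHom.mk' (y s) (h2 s))
                 naturality := ?_ } :
        (resSmall R).obj G.unop ⟶ (resSmall R).obj ((tensorEmb R).obj M)), rfl⟩
      intro s s' c
      ext g
      have h4 := h1 c g 0
      rw [h3, add_zero, add_zero] at h4
      exact h4.symm
    · rintro ⟨η, rfl⟩
      funext j
      obtain ⟨s, s', c, g, h⟩ := j
      change (resSmall R).obj G.unop ⟶ (resSmall R).obj ((tensorEmb R).obj M) at η
      refine sub_eq_zero.2 (Eq.trans ?_ (map_add (η.app s').hom (G'.map c g) h).symm)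
      exact congrArg (· + _) (ConcreteCategory.congr_hom (η.naturality c) g).symm

end Tensor

/-! ### The adjunction `t ⊣ ev_R`, and injective functors as tensor functors. -/

section TensorAdjunction
variable {R : Type u} [Ring R]

/-- The morphism `R ⟶ L`, `r ↦ r l`. -/
def spanSingle {L : FpLeftMod R} (l : L.obj) : leftReg R ⟶ L :=
  ObjectProperty.homMk (ModuleCat.ofHom (LinearMap.toSpanSingleton R L.obj l))

lemma spanSingle_comp {L K : FpLeftMod R} (l : L.obj) (f : L ⟶ K) :
    spanSingle l ≫ f = spanSingle (f.hom.hom l) := by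
  refine ObjectProperty.hom_ext _ (ModuleCat.hom_ext (LinearMap.ext fun (r : R) => ?_))
  exact map_smul f.hom.hom r l

lemma spanSingle_add {L : FpLeftMod R} (l l' : L.obj) :
    spanSingle (l + l') = spanSingle l + spanSingle l' :=
  ObjectProperty.hom_ext _ (ModuleCat.hom_ext (LinearMap.ext fun (r : R) => smul_add r l l'))

lemma spanSingle_smul {L : FpLeftMod R} (r : R) (l : L.obj) :
    spanSingle (r • l) = rightMul (MulOpposite.op r) ≫ spanSingle l :=
  ObjectProperty.hom_ext _ (ModuleCat.hom_ext (LinearMap.ext fun (s : R) => (mul_smul s r l).symm))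

lemma spanSingle_one : spanSingle (L := leftReg R) (1 : R) = 𝟙 (leftReg R) :=
  ObjectProperty.hom_ext _ (ModuleCat.hom_ext (LinearMap.ext fun (s : R) => mul_one s))

/-- The homomorphism `G(R) ⊗ L ⟶ G(L)`, `x ⊗ l ↦ G(r ↦ r l)(x)`. -/
def tensorEvApp (G : AddFun R) (L : FpLeftMod R) :
    Tensor ((evR R).obj G) L.obj →+ G.obj.obj L :=
  Tensor.lift (AddMonoidHom.mk' (fun x => AddMonoidHom.mk'
      (fun l => G.obj.map (spanSingle l) (show G.obj.obj (leftReg R) from x)) fun l l' => by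
        rw [spanSingle_add, G.obj.map_add]; rfl) fun x y => by
          ext l; exact map_add (G.obj.map (spanSingle l)).hom _ _)
    fun r x l => by
      change G.obj.map (spanSingle l) (G.obj.map (rightMul (MulOpposite.op r)) _) =
        G.obj.map (spanSingle (r • l)) _
      rw [spanSingle_smul, G.obj.map_comp]
      rfl

lemma tensorEvApp_mk (G : AddFun R) (L : FpLeftMod R) (x : G.obj.obj (leftReg R)) (l : L.obj) :
    tensorEvApp G L (Tensor.mk (X := (evR R).obj G) x l) = G.obj.map (spanSingle l) x := rfl

variable (R) in
/-- The adjunction between `X ↦ X ⊗ -` and evaluation at `R`. -/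
def tensorAdj : tensorEmb R ⊣ evR R :=
  Adjunction.mkOfUnitCounit
    { unit :=
        { app := fun X => toEvTensor X
          naturality := fun X Y f => rfl }
      counit :=
        { app := fun G => ObjectProperty.homMk
            { app := fun L => AddCommGrpCat.ofHom (tensorEvApp G L)
              naturality := fun K L f => by
                ext1
                refine Tensor.hom_ext fun x l => ?_
                change G.obj.map (spanSingle (f.hom.hom l)) x =
                  G.obj.map f (G.obj.map (spanSingle l) x)
                rw [← spanSingle_comp, G.obj.map_comp]
                rfl }
          naturality := fun G H α => by
            ext L : 4
            refine Tensor.hom_ext fun x l => ?_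
            exact (ConcreteCategory.congr_hom (α.hom.naturality (spanSingle l)) x).symm }
      left_triangle := by
        ext X L : 6
        refine Tensor.hom_ext fun x l => ?_
        change Tensor.mk x ((spanSingle l).hom.hom (1 : R)) = Tensor.mk x l
        exact congrArg _ (one_smul R l)
      right_triangle := by
        ext G x
        change G.obj.map (spanSingle (L := leftReg R) (1 : R)) x = x
        rw [spanSingle_one, G.obj.map_id]
        rfl }

lemma tensorAdj_unit_app (X : RightMod R) : (tensorAdj R).unit.app X = toEvTensor X := rfl

lemma tensorEvApp_naturality (G : AddFun R) {K L : FpLeftMod R} (f : K ⟶ L)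
    (z : Tensor ((evR R).obj G) K.obj) :
    tensorEvApp G L (Tensor.map (𝟙 _) f.hom z) = G.obj.map f (tensorEvApp G K z) :=
  ConcreteCategory.congr_hom (((tensorAdj R).counit.app G).hom.naturality f) z

lemma Tensor.exists_mk_one {X : RightMod R} (z : Tensor X (leftReg R).obj) :
    ∃ x : X, (Tensor.mk x (1 : R) : Tensor X (leftReg R).obj) = z := by
  refine Tensor.induction_on (P := fun z => ∃ x : X, (Tensor.mk x (1 : R) : Tensor X (leftReg R).obj) = z) z
    ⟨0, map_zero (Tensor.mkLeft X (L := (leftReg R).obj) (1 : R))⟩ ?_ ?_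
  · intro x (r : R)
    exact ⟨MulOpposite.op r • x, (Tensor.smul_mk (L := (leftReg R).obj) x r (1 : R)).trans
      (congrArg (Tensor.mk x) (mul_one r))⟩
  · rintro _ _ ⟨x, rfl⟩ ⟨y, rfl⟩
    exact ⟨x + y, Tensor.add_mk (L := (leftReg R).obj) x y (1 : R)⟩

/-- Every element of `G(R) ⊗ R` has the form `x ⊗ 1`, and it is sent to `x`. -/
lemma tensorEvApp_leftReg_bijective (G : AddFun R) :
    Function.Bijective (tensorEvApp G (leftReg R)) := by
  have h : ∀ x : (evR R).obj G, tensorEvApp G (leftReg R)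
      (Tensor.mk x (1 : R) : Tensor _ (leftReg R).obj) = x := by
    intro x
    refine (tensorEvApp_mk G (leftReg R) x (1 : R)).trans ?_
    rw [spanSingle_one, G.obj.map_id]
    rfl
  refine ⟨(injective_iff_map_eq_zero _).2 fun z hz => ?_, fun x => ⟨_, h x⟩⟩
  obtain ⟨x, rfl⟩ := Tensor.exists_mk_one z
  have hx : x = 0 := (h x).symm.trans hz
  rw [hx]
  exact map_zero (Tensor.mkLeft _ (L := (leftReg R).obj) (1 : R))

variable (R) in
/-- The free left module of rank `n`. -/
def freeLeft (n : ℕ) : FpLeftMod R :=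
  ⟨ModuleCat.of R (Fin n → R), (inferInstance : Module.FinitePresentation R (Fin n → R))⟩

/-- The coordinate projections of a free left module. -/
def freeLeftProj {n : ℕ} (k : Fin n) : freeLeft R n ⟶ leftReg R :=
  ObjectProperty.homMk (ModuleCat.ofHom (LinearMap.proj k : (Fin n → R) →ₗ[R] R))

/-- The coordinate inclusions of a free left module. -/
def freeLeftIncl {n : ℕ} (k : Fin n) : leftReg R ⟶ freeLeft R n :=
  ObjectProperty.homMk (ModuleCat.ofHom (LinearMap.single R (fun _ : Fin n => R) k))

lemma sum_freeLeftProj_comp_freeLeftIncl (n : ℕ) :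
    ∑ k, freeLeftProj k ≫ freeLeftIncl k = 𝟙 (freeLeft R n) := by
  refine ObjectProperty.hom_ext _ (ModuleCat.hom_ext (LinearMap.ext fun (v : Fin n → R) => ?_))
  let ev : (freeLeft R n ⟶ freeLeft R n) →+ (Fin n → R) :=
    AddMonoidHom.mk' (fun f => f.hom.hom v) fun f g => rfl
  refine (map_sum ev _ _).trans ?_
  exact Finset.univ_sum_single v

lemma freeLeft_map_sum (G : AddFun R) {n : ℕ} (z : G.obj.obj (freeLeft R n)) :
    ∑ k, G.obj.map (freeLeftIncl k) (G.obj.map (freeLeftProj k) z) = z := by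
  have : G.obj.Additive := G.property
  let ev : (freeLeft R n ⟶ freeLeft R n) →+ G.obj.obj (freeLeft R n) :=
    AddMonoidHom.mk' (fun f => G.obj.map f z) fun f g => by
      rw [G.obj.map_add]; rfl
  have h := congrArg ev (sum_freeLeftProj_comp_freeLeftIncl n)
  rw [map_sum] at h
  refine Eq.trans (Finset.sum_congr rfl fun k _ => ?_) (h.trans ?_)
  · exact (ConcreteCategory.congr_hom (G.obj.map_comp _ _) z).symm
  · exact ConcreteCategory.congr_hom (G.obj.map_id _) z

/-- Both sides are additive functors, so the case of `R` extends to `R^n` through its coordinate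
projections and inclusions. -/
lemma tensorEvApp_freeLeft_bijective (G : AddFun R) (n : ℕ) :
    Function.Bijective (tensorEvApp G (freeLeft R n)) := by
  constructor
  · refine (injective_iff_map_eq_zero _).2 fun z hz => ?_
    have h1 : ∀ k, Tensor.map (𝟙 ((evR R).obj G)) (freeLeftProj k).hom z = 0 := fun k =>
      (tensorEvApp_leftReg_bijective G).1 (by
        rw [tensorEvApp_naturality, hz, map_zero, map_zero])
    refine (freeLeft_map_sum ((tensorEmb R).obj ((evR R).obj G)) z).symm.trans ?_
    refine Finset.sum_eq_zero fun k _ => ?_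
    exact (congrArg (Tensor.map (𝟙 _) (freeLeftIncl k).hom) (h1 k)).trans (map_zero _)
  · intro z
    choose y hy using fun k => (tensorEvApp_leftReg_bijective G).2 (G.obj.map (freeLeftProj k) z)
    refine ⟨∑ k, Tensor.map (𝟙 _) (freeLeftIncl k).hom (y k), ?_⟩
    rw [map_sum]
    refine Eq.trans (Finset.sum_congr rfl fun k _ => ?_) (freeLeft_map_sum G z)
    rw [tensorEvApp_naturality, hy]

/-- The functor `(L, -)` on finitely presented left modules. -/
def addRep (L : FpLeftMod R) : AddFun R :=
  ⟨preadditiveCoyoneda.obj (op L), inferInstanceAs (preadditiveCoyoneda.obj (op L)).Additive⟩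

/-- The morphism `(L, -) ⟶ G` corresponding to an element of `G(L)`. -/
def addRepDesc (G : AddFun R) {L : FpLeftMod R} (y : G.obj.obj L) : addRep L ⟶ G :=
  ObjectProperty.homMk
    { app := fun M => AddCommGrpCat.ofHom (AddMonoidHom.mk' (fun h : L ⟶ M => G.obj.map h y)
        fun (h : L ⟶ M) (h' : L ⟶ M) =>
          ConcreteCategory.congr_hom (G.obj.map_add (f := h) (g := h')) y)
      naturality := fun M N f => by
        ext (h : L ⟶ M)
        exact ConcreteCategory.congr_hom (G.obj.map_comp h f) y }

/-- The morphism `(L, -) ⟶ (K, -)` given by precomposition. -/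
def addRepMap {K L : FpLeftMod R} (f : K ⟶ L) : addRep L ⟶ addRep K :=
  addRepDesc (addRep K) (show K ⟶ L from f)

lemma addRep_apply (G : AddFun R) {K M : FpLeftMod R} (ψ : addRep K ⟶ G) (h : K ⟶ M) :
    ψ.hom.app M h = G.obj.map h (ψ.hom.app K (𝟙 K)) := by
  refine Eq.trans ?_ (ConcreteCategory.congr_hom (ψ.hom.naturality h) (𝟙 K))
  exact congrArg (ψ.hom.app M) (Category.id_comp h).symm

/-- A surjection `K ⟶ L` makes `(L, -) ⟶ (K, -)` mono, so a map `(L, -) ⟶ I`, that is an element of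
`I(L)`, extends to `(K, -)`. -/
lemma map_surjective_of_injective (I : AddFun R) [Injective I] {K L : FpLeftMod R} (f : K ⟶ L)
    (hf : Function.Surjective f.hom.hom) : Function.Surjective (I.obj.map f) := by
  intro y
  have : Mono (addRepMap f) := by
    refine (additiveFunctor _ AddCommGrpCat.{u}).ι.mono_of_mono_map
      (mono_of_app_injective (addRepMap f).hom fun M (h : L ⟶ M) (h' : L ⟶ M) e => ?_)
    refine ObjectProperty.hom_ext _ (ModuleCat.hom_ext (LinearMap.ext fun l => ?_))
    obtain ⟨k, rfl⟩ := hf l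
    exact congrArg (fun g : K ⟶ M => g.hom.hom k) e
  let ψ : addRep K ⟶ I := Injective.factorThru (addRepDesc I y) (addRepMap f)
  refine ⟨ψ.hom.app K (𝟙 K), ?_⟩
  rw [← addRep_apply]
  have h := ConcreteCategory.congr_hom (congr_app (congrArg InducedCategory.Hom.hom
    (Injective.comp_factorThru (addRepDesc I y) (addRepMap f))) L) (𝟙 L)
  refine Eq.trans ?_ (h.trans (ConcreteCategory.congr_hom (I.obj.map_id L) y))
  exact congrArg (ψ.hom.app L) (Category.comp_id f).symm

/-- The sequence `(L, -) ⟶ (N, -) ⟶ (K, -)` is exact. An element `z` killed by `I(q)` is a map `(N,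
-) ⟶ I` vanishing on `(L, -)`, so it extends to `(K, -)` by injectivity. With
`map_surjective_of_injective`, this says that `I` is right exact. -/
lemma map_exact_of_injective (I : AddFun R) [Injective I] {K N L : FpLeftMod R} (f : K ⟶ N)
    (q : N ⟶ L) (hq : Function.Surjective q.hom.hom) (hfq : Function.Exact f.hom.hom q.hom.hom)
    (z : I.obj.obj N) (hz : I.obj.map q z = 0) : ∃ w, I.obj.map f w = z := by
  have hfq0 : f.hom ≫ q.hom = 0 :=
    ModuleCat.hom_ext (LinearMap.ext fun k => hfq.apply_apply_eq_zero k)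
  have hS : (ShortComplex.mk f.hom q.hom hfq0).Exact :=
    (ShortComplex.ShortExact.moduleCat_exact_iff_function_exact _).2 hfq
  have : Epi q.hom := (ModuleCat.epi_iff_surjective _).2 hq
  have h0 : kernel.ι (addRepMap f) ≫ addRepDesc I z = 0 := by
    ext M x
    let h : N ⟶ M := (kernel.ι (addRepMap f)).hom.app M x
    have h1 : f ≫ h = 0 := ConcreteCategory.congr_hom (congr_app (congrArg
      InducedCategory.Hom.hom (kernel.condition (addRepMap f))) M) x
    have h2 : f.hom ≫ h.hom = 0 := congrArg InducedCategory.Hom.hom h1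
    let h' : L ⟶ M := ObjectProperty.homMk (hS.desc h.hom h2)
    have h3 : q ≫ h' = h := ObjectProperty.hom_ext _ (hS.g_desc h.hom h2)
    change I.obj.map h z = 0
    rw [← h3, I.obj.map_comp]
    exact (congrArg (I.obj.map h') hz).trans (map_zero _)
  let S : ShortComplex (AddFun R) := .mk (kernel.ι (addRepMap f)) (addRepMap f) (kernel.condition _)
  have hS' : S.Exact := ShortComplex.exact_of_f_is_kernel _ (kernelIsKernel _)
  let ψ : addRep K ⟶ I := hS'.descToInjective (addRepDesc I z) h0
  have hψ : addRepMap f ≫ ψ = addRepDesc I z := hS'.comp_descToInjective _ h0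
  refine ⟨ψ.hom.app K (𝟙 K), ?_⟩
  rw [← addRep_apply]
  have h := ConcreteCategory.congr_hom (congr_app (congrArg InducedCategory.Hom.hom hψ) N) (𝟙 N)
  refine Eq.trans ?_ (h.trans (ConcreteCategory.congr_hom (I.obj.map_id N) z))
  exact congrArg (ψ.hom.app N) (Category.comp_id f).symm

lemma Tensor.map_surjective (X : RightMod R) {K L : FpLeftMod R} (f : K ⟶ L)
    (hf : Function.Surjective f.hom.hom) : Function.Surjective (Tensor.map (𝟙 X) f.hom) := by
  intro z
  refine Tensor.induction_on (P := fun z => ∃ y, Tensor.map (𝟙 X) f.hom y = z) z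
    ⟨0, map_zero _⟩ ?_ ?_
  · intro x l
    obtain ⟨k, rfl⟩ := hf l
    exact ⟨Tensor.mk x k, rfl⟩
  · rintro _ _ ⟨y, rfl⟩ ⟨y', rfl⟩
    exact ⟨y + y', map_add _ _ _⟩

/-- An injective functor `I` is isomorphic to `I(R) ⊗ -`. -/
lemma tensorEvApp_bijective_of_injective (I : AddFun R) [Injective I] (L : FpLeftMod R) :
    Function.Bijective (tensorEvApp I L) := by
  have := L.property
  obtain ⟨n, m, q, f, hq, hfq⟩ := Module.FinitePresentation.exists_fin' R L.obj
  let q' : freeLeft R n ⟶ L := ObjectProperty.homMk (ModuleCat.ofHom q)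
  let f' : freeLeft R m ⟶ freeLeft R n := ObjectProperty.homMk (ModuleCat.ofHom f)
  constructor
  -- Diagram chase along `R^m ⟶ R^n ⟶ L ⟶ 0`: `I` is exact on it, its tensor product with `I(R)` is
  -- a surjective complex, and the comparison is bijective on the free modules.
  · refine (injective_iff_map_eq_zero _).2 fun z hz => ?_
    obtain ⟨y, rfl⟩ := Tensor.map_surjective _ q' hq z
    rw [tensorEvApp_naturality] at hz
    obtain ⟨w, hw⟩ := map_exact_of_injective I f' q' hq hfq _ hz
    obtain ⟨v, rfl⟩ := (tensorEvApp_freeLeft_bijective I m).2 w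
    rw [← tensorEvApp_naturality] at hw
    rw [← (tensorEvApp_freeLeft_bijective I n).1 hw]
    refine (ConcreteCategory.congr_hom (((tensorEmb R).obj _).obj.map_comp f' q') v).symm.trans ?_
    have h0 : f' ≫ q' = 0 := ObjectProperty.hom_ext _
      (ModuleCat.hom_ext (LinearMap.ext fun k => hfq.apply_apply_eq_zero k))
    have : ((tensorEmb R).obj ((evR R).obj I)).obj.Additive := ((tensorEmb R).obj _).property
    rw [h0, Functor.map_zero]
    rfl
  · intro y
    obtain ⟨z, rfl⟩ := map_surjective_of_injective I q' hq y
    obtain ⟨v, rfl⟩ := (tensorEvApp_freeLeft_bijective I n).2 z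
    exact ⟨_, tensorEvApp_naturality I q' v⟩

instance isIso_tensorAdj_counit_app (I : AddFun R) [Injective I] :
    IsIso ((tensorAdj R).counit.app I) := by
  have : ∀ L, IsIso (((tensorAdj R).counit.app I).hom.app L) := fun L =>
    (ConcreteCategory.isIso_iff_bijective _).2 (tensorEvApp_bijective_of_injective I L)
  have : IsIso ((tensorAdj R).counit.app I).hom := NatIso.isIso_of_isIso_app _
  have : IsIso ((additiveFunctor _ AddCommGrpCat.{u}).ι.map ((tensorAdj R).counit.app I)) := this
  exact isIso_of_reflects_iso ((tensorAdj R).counit.app I) (additiveFunctor _ AddCommGrpCat.{u}).ι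

end TensorAdjunction

/-! ### The Yoneda lemma inside `fp(A, Ab)`. -/

section Yoneda
variable {A : Type u} [Category.{v} A] [Abelian A]

instance : (Yon A).Full := inferInstanceAs (ObjectProperty.lift _ _ _).Full

instance : (Yon A).Faithful := inferInstanceAs (ObjectProperty.lift _ _ _).Faithful

/-- The morphism `(M, -) ⟶ F` corresponding to an element of `F(M)`. -/
def yonDesc (F : FP A) {M : A} (z : F.obj.obj M) : (Yon A).obj (op M) ⟶ F :=
  have := F.property.additive
  ObjectProperty.homMk
    { app := fun N => AddCommGrpCat.ofHom (AddMonoidHom.mk' (fun g : M ⟶ N => F.obj.map g z)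
        fun (g : M ⟶ N) (h : M ⟶ N) =>
          ConcreteCategory.congr_hom (F.obj.map_add (f := g) (g := h)) z)
      naturality := fun N N' f => by
        ext (g : M ⟶ N)
        exact ConcreteCategory.congr_hom (F.obj.map_comp g f) z }

lemma yon_hom_ext {F : FP A} {M : A} {f g : (Yon A).obj (op M) ⟶ F}
    (h : f.hom.app M (𝟙 M) = g.hom.app M (𝟙 M)) : f = g := by
  ext N (k : M ⟶ N)
  have h1 := nat (p := (f.hom : Rep M ⟶ F.obj)) (𝟙 M) k
  have h2 := nat (p := (g.hom : Rep M ⟶ F.obj)) (𝟙 M) k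
  rw [Category.id_comp] at h1 h2
  exact h1.trans ((congrArg (F.obj.map k) h).trans h2.symm)

lemma yonDesc_apply_id (F : FP A) {M : A} (z : F.obj.obj M) :
    (yonDesc F z).hom.app M (𝟙 M) = z :=
  ConcreteCategory.congr_hom (F.obj.map_id M) z

lemma yonDesc_add (F : FP A) {M : A} (y z : F.obj.obj M) :
    yonDesc F (y + z) = yonDesc F y + yonDesc F z :=
  yon_hom_ext ((yonDesc_apply_id F _).trans
    (congrArg₂ (· + ·) (yonDesc_apply_id F y) (yonDesc_apply_id F z)).symm)

lemma yonDesc_comp {F G : FP A} (f : F ⟶ G) {M : A} (z : F.obj.obj M) :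
    yonDesc F z ≫ f = yonDesc G (f.hom.app M z) :=
  yon_hom_ext ((congrArg (f.hom.app M) (yonDesc_apply_id F z)).trans (yonDesc_apply_id G _).symm)

lemma yonDesc_id (M : A) : yonDesc ((Yon A).obj (op M)) (𝟙 M) = 𝟙 _ :=
  yon_hom_ext (yonDesc_apply_id _ _)

lemma yonDesc_map (F : FP A) {M N : A} (f : M ⟶ N) (z : F.obj.obj M) :
    yonDesc F (F.obj.map f z) = (Yon A).map f.op ≫ yonDesc F z := by
  refine yon_hom_ext ((yonDesc_apply_id F _).trans ?_)
  change F.obj.map f z = F.obj.map (f ≫ 𝟙 N) z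
  rw [Category.comp_id]

end Yoneda

/-! ### The adjunction `D_A ⊣ D_R`. -/

section RightAdjoint
variable {R : Type u} [Ring R]

instance : (DA R).Additive := rightDerived_zero_additive (wFun (RightMod R) ⋙ tensorEmb R)

instance : (DL R).Additive := leftDerived_zero_additive ((evR R).op ⋙ Yon (RightMod R))

instance (X : RightMod R) : IsIso (tensorToDA X) := by
  have : IsIso ((wFun (RightMod R) ⋙ tensorEmb R).toRightDerivedZero.app (op (yon X))) :=
    inferInstance
  exact IsIso.comp_isIso' inferInstance this

lemma tensorToDA_naturality {X Y : RightMod R} (f : X ⟶ Y) :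
    (tensorEmb R).map f ≫ tensorToDA Y =
      tensorToDA X ≫ (DA R).map ((Yon (RightMod R)).map f.op).op := by
  let T := wFun (RightMod R) ⋙ tensorEmb R
  let adj := Adjunction.ofIsRightAdjoint (Yon (RightMod R))
  let c (X : RightMod R) : X ⟶ (wFun (RightMod R)).obj (op (yon X)) := (adj.counit.app (op X)).unop
  let l (X : RightMod R) :
      (tensorEmb R).obj ((wFun (RightMod R)).obj (op (yon X))) ⟶ (DA R).obj (op (yon X)) :=
    T.toRightDerivedZero.app (op (yon X))
  have h1 : (tensorEmb R).map ((wFun (RightMod R)).map ((Yon (RightMod R)).map f.op).op) ≫ l Y =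
      l X ≫ (DA R).map ((Yon (RightMod R)).map f.op).op :=
    T.toRightDerivedZero.naturality _
  have h2 : f ≫ c Y = c X ≫ (wFun (RightMod R)).map ((Yon (RightMod R)).map f.op).op :=
    (congrArg Quiver.Hom.unop (adj.counit.naturality f.op)).symm
  change (tensorEmb R).map f ≫ (tensorEmb R).map (c Y) ≫ l Y =
    ((tensorEmb R).map (c X) ≫ l X) ≫ _
  rw [Category.assoc, ← h1, ← Functor.map_comp_assoc, h2, Functor.map_comp_assoc]

lemma inv_tensorToDA_naturality {X Y : RightMod R} (f : X ⟶ Y) :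
    (DA R).map ((Yon (RightMod R)).map f.op).op ≫ inv (tensorToDA Y) =
      inv (tensorToDA X) ≫ (tensorEmb R).map f := by
  rw [IsIso.eq_inv_comp, ← Category.assoc, ← tensorToDA_naturality, Category.assoc,
    IsIso.hom_inv_id, Category.comp_id]

instance : (resSmall R).Faithful := by
  unfold resSmall
  infer_instance

instance : (resSmall R).Full := by
  unfold resSmall
  infer_instance

/-- Left exactness of the right derived functor, read in `fp(Mod(R), Ab)` instead of its opposite:
`D_A F` is the kernel of `D_A P₀ ⟶ D_A P₁`. -/
lemma exists_presentation_DA (F : FpFun R) :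
    ∃ (P₁ P₀ : FpFun R) (d : P₁ ⟶ P₀) (π : P₀ ⟶ F) (_ : d ≫ π = 0), Projective P₁ ∧
      Projective P₀ ∧ Epi π ∧ Mono ((DA R).map π.op) ∧
      ∀ {Z : AddFun R} (z : Z ⟶ (DA R).obj (op P₀)), z ≫ (DA R).map d.op = 0 →
        ∃ y : Z ⟶ (DA R).obj (op F), y ≫ (DA R).map π.op = z := by
  obtain ⟨I₀, I₁, ι, d, w, _, _, _, _, hm, hz⟩ :=
    exists_copresentation_rightDerived_zero (wFun (RightMod R) ⋙ tensorEmb R) (op F)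
  refine ⟨I₁.unop, I₀.unop, d.unop, ι.unop, congrArg Quiver.Hom.unop w, inferInstance,
    inferInstance, inferInstance, hm, hz⟩

variable (R) in
/-- The functor `D_R`. -/
abbrev DR' : (AddFun R)ᵒᵖ ⥤ FpFun R := DR R isFP_DRfun

/-- The value at `z ∈ F(M)` of the natural transformation `F ⟶ D_R G` corresponding to
`g : G ⟶ D_A F`. -/
def toDRApp {G : AddFun R} {F : FpFun R} (g : G ⟶ (DA R).obj (op F)) {M : RightMod R}
    (z : F.obj.obj M) : G ⟶ (tensorEmb R).obj M :=
  g ≫ (DA R).map (yonDesc F z).op ≫ inv (tensorToDA M)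

lemma toDRApp_add {G : AddFun R} {F : FpFun R} (g : G ⟶ (DA R).obj (op F)) {M : RightMod R}
    (y z : F.obj.obj M) : toDRApp g (y + z) = toDRApp g y + toDRApp g z := by
  simp [toDRApp, yonDesc_add, op_add, Functor.map_add]

lemma toDRApp_map {G : AddFun R} {F : FpFun R} (g : G ⟶ (DA R).obj (op F)) {M N : RightMod R}
    (f : M ⟶ N) (z : F.obj.obj M) :
    toDRApp g (F.obj.map f z) = toDRApp g z ≫ (tensorEmb R).map f := by
  simp only [toDRApp, yonDesc_map, op_comp, Functor.map_comp, Category.assoc,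
    inv_tensorToDA_naturality]

/-- The natural transformation `F ⟶ D_R G` corresponding to `g : G ⟶ D_A F`. -/
def toDR {G : AddFun R} {F : FpFun R} (g : G ⟶ (DA R).obj (op F)) : F ⟶ (DR' R).obj (op G) :=
  ObjectProperty.homMk
    { app := fun M => AddCommGrpCat.ofHom (AddMonoidHom.mk'
        (fun z : F.obj.obj M => (resSmall R).map (toDRApp g z)) fun y z => by
          rw [toDRApp_add]; rfl)
      naturality := fun M N f => by
        ext z
        change (resSmall R).map (toDRApp g (F.obj.map f z)) =
          (resSmall R).map (toDRApp g z) ≫ (resSmall R).map ((tensorEmb R).map f)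
        rw [toDRApp_map, Functor.map_comp] }

lemma toDR_comp_DA_map {G : AddFun R} {F F' : FpFun R} (g : G ⟶ (DA R).obj (op F)) (f : F' ⟶ F) :
    toDR (g ≫ (DA R).map f.op) = f ≫ toDR g := by
  ext M z
  change (resSmall R).map (toDRApp (g ≫ (DA R).map f.op) z) =
    (resSmall R).map (toDRApp g (f.hom.app M z))
  simp only [toDRApp, ← yonDesc_comp, op_comp, Functor.map_comp, Category.assoc]

lemma toDR_comp {G G' : AddFun R} {F : FpFun R} (f : G' ⟶ G) (g : G ⟶ (DA R).obj (op F)) :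
    toDR (f ≫ g) = toDR g ≫ (DR' R).map f.op := by
  ext M z
  change (resSmall R).map (toDRApp (f ≫ g) z) =
    (resSmall R).map f ≫ (resSmall R).map (toDRApp g z)
  rw [← Functor.map_comp]
  simp only [toDRApp, Category.assoc]

lemma toDR_zero (G : AddFun R) (F : FpFun R) : toDR (0 : G ⟶ (DA R).obj (op F)) = 0 := by
  ext M z
  change (resSmall R).map (toDRApp 0 z) = 0
  rw [toDRApp, zero_comp]
  rfl

lemma toDRApp_id {G : AddFun R} {X : RightMod R} (g : G ⟶ (DA R).obj (op (yon X))) :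
    toDRApp g (𝟙 X : X ⟶ X) = g ≫ inv (tensorToDA X) := by
  refine (congrArg (fun k : yon X ⟶ yon X => g ≫ (DA R).map k.op ≫ inv (tensorToDA X))
    (yonDesc_id X)).trans ?_
  rw [op_id, CategoryTheory.Functor.map_id, Category.id_comp]

/-- The value of a natural transformation to `D_R G` at an element, as a natural
transformation. -/
def DRval {G : AddFun R} {F : FpFun R} (β : F ⟶ (DR' R).obj (op G)) {M : RightMod R}
    (z : F.obj.obj M) : (resSmall R).obj G ⟶ (resSmall R).obj ((tensorEmb R).obj M) :=
  β.hom.app M z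

/-- Under Yoneda, `toDR` for a representable functor is composition with `D_A(X, -) ≅ X ⊗ -`. This
yields both the bijectivity on representables and the formula for the unit `δ`. -/
lemma DRval_toDR_id {G : AddFun R} {X : RightMod R} (g : G ⟶ (DA R).obj (op (yon X))) :
    DRval (F := yon X) (toDR g) (𝟙 X : X ⟶ X) = (resSmall R).map (g ≫ inv (tensorToDA X)) :=
  congrArg (resSmall R).map (toDRApp_id g)

lemma toDR_bijective_yon (G : AddFun R) (X : RightMod R) :
    Function.Bijective (toDR : (G ⟶ (DA R).obj (op (yon X))) → _) := by
  constructor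
  · intro g h e
    have h1 : (resSmall R).map (g ≫ inv (tensorToDA X)) =
        (resSmall R).map (h ≫ inv (tensorToDA X)) := by
      rw [← DRval_toDR_id, ← DRval_toDR_id, e]
    exact (cancel_mono _).1 ((resSmall R).map_injective h1)
  · intro β
    let b := DRval (F := yon X) β (𝟙 X : X ⟶ X)
    have h1 : DRval (F := yon X) (toDR ((resSmall R).preimage b ≫ tensorToDA X)) (𝟙 X : X ⟶ X) =
        b := by
      rw [DRval_toDR_id, Category.assoc, IsIso.hom_inv_id, Category.comp_id, Functor.map_preimage]
    exact ⟨_, yon_hom_ext h1⟩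

lemma exists_yon_retract (P : FpFun R) [Projective P] :
    ∃ (X : RightMod R) (i : P ⟶ yon X) (r : yon X ⟶ P), i ≫ r = 𝟙 P := by
  obtain ⟨X, Y, a, p, hp⟩ := (isFP_iff P.obj).1 P.property
  have : Epi (ObjectProperty.homMk p : yon X ⟶ P) :=
    (IsFP (A := RightMod R)).ι.epi_of_epi_map (epi_of_app_surjective p fun M => (hp M).2)
  exact ⟨X, Projective.factorThru (𝟙 P) (ObjectProperty.homMk p), _, Projective.factorThru_comp _ _⟩

/-- Projectives are retracts of representables, and a retract of a natural bijection is a bijection.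
-/
lemma toDR_bijective_of_projective (G : AddFun R) (P : FpFun R) [Projective P] :
    Function.Bijective (toDR : (G ⟶ (DA R).obj (op P)) → _) := by
  obtain ⟨X, i, r, hir⟩ := exists_yon_retract P
  have h : (DA R).map r.op ≫ (DA R).map i.op = 𝟙 _ := by
    rw [← Functor.map_comp, ← op_comp, hir, op_id, CategoryTheory.Functor.map_id]
  constructor
  · intro g g' e
    have h1 : g ≫ (DA R).map r.op = g' ≫ (DA R).map r.op :=
      (toDR_bijective_yon G X).1 (by rw [toDR_comp_DA_map, toDR_comp_DA_map, e])
    rw [← Category.comp_id g, ← h, reassoc_of% h1, h, Category.comp_id]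
  · intro β
    obtain ⟨g, hg⟩ := (toDR_bijective_yon G X).2 (r ≫ β)
    exact ⟨g ≫ (DA R).map i.op, by
      rw [toDR_comp_DA_map, hg, reassoc_of% hir]⟩

/-- `Hom(G, D_A -)` and `Hom(-, D_R G)` both turn a suitable projective presentation of `F` into a
left exact sequence, so the projective case suffices. -/
lemma toDR_bijective (G : AddFun R) (F : FpFun R) :
    Function.Bijective (toDR : (G ⟶ (DA R).obj (op F)) → _) := by
  obtain ⟨P₁, P₀, d, π, w, _, _, _, _, hz⟩ := exists_presentation_DA F
  constructor
  · intro g g' e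
    rw [← cancel_mono ((DA R).map π.op)]
    exact (toDR_bijective_of_projective G P₀).1 (by rw [toDR_comp_DA_map, toDR_comp_DA_map, e])
  · intro β
    obtain ⟨g₀, hg₀⟩ := (toDR_bijective_of_projective G P₀).2 (π ≫ β)
    -- The composite of `g₀` with `D_A d` corresponds to `d ≫ π ≫ β = 0`, so `g₀` factors through
    -- the kernel `D_A F`.
    obtain ⟨g, hg⟩ := hz g₀ ((toDR_bijective_of_projective G P₁).1 (by
      rw [toDR_comp_DA_map, hg₀, reassoc_of% w, zero_comp, toDR_zero]))
    refine ⟨g, ?_⟩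
    rw [← cancel_epi π, ← toDR_comp_DA_map, hg, hg₀]

variable (R) in
/-- The adjunction `D_A ⊣ D_R`. -/
def adjDADR : (DA R).rightOp ⊣ DR' R :=
  Adjunction.mkOfHomEquiv
    { homEquiv := fun F G => Equiv.ofBijective
        (fun g : (DA R).rightOp.obj F ⟶ G => toDR g.unop)
        ((toDR_bijective G.unop F).comp (opEquiv _ _).bijective)
      homEquiv_naturality_left_symm := fun {F' F G} f g => by
        rw [Equiv.symm_apply_eq]
        refine Eq.trans ?_ (toDR_comp_DA_map _ f).symm
        exact congrArg (f ≫ ·) ((Equiv.ofBijective _ ((toDR_bijective G.unop F).comp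
          (opEquiv _ _).bijective)).apply_symm_apply g).symm
      homEquiv_naturality_right := fun {F G G'} f g => toDR_comp g.unop f.unop }

lemma adjDADR_unit_app (F : FpFun R) :
    (adjDADR R).unit.app F = toDR (𝟙 ((DA R).obj (op F))) := rfl

/-- The unit is `toDR` of an identity, so its value at `𝟙 X` is the inverse of `tensorToDA X`. -/
lemma resSmall_map_tensorToDA_deltaRep (X : RightMod R) :
    (resSmall R).map (tensorToDA X) ≫ deltaRep (adjDADR R).unit X = 𝟙 _ := by
  have h : deltaRep (adjDADR R).unit X = (resSmall R).map (inv (tensorToDA X)) := by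
    refine (congrArg (fun β => DRval (F := yon X) β (𝟙 X : X ⟶ X)) (adjDADR_unit_app _)).trans ?_
    exact (DRval_toDR_id _).trans (congrArg (resSmall R).map (Category.id_comp _))
  rw [h, ← Functor.map_comp, IsIso.hom_inv_id, CategoryTheory.Functor.map_id]

end RightAdjoint

/-! ### The isomorphism `D_A D_L ≅ 1` and the adjunction `D_L ⊣ D_A`. -/

section LeftAdjoint
variable {R : Type u} [Ring R]

instance mono_DA_map_of_epi {F F' : FpFun R} (π : F ⟶ F') [Epi π] : Mono ((DA R).map π.op) where
  right_cancellation g h e := (toDR_bijective _ _).1 (by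
    rw [← cancel_epi π, ← toDR_comp_DA_map, e, toDR_comp_DA_map])

/-- Through `toDR`, maps `Z ⟶ D_A F` are maps `F ⟶ D_R Z`, and these factor through the cokernel
`S.X₃`. So `D_A` is exact on arbitrary right exact sequences, not only on the chosen resolution. -/
lemma exact_DA {S : ShortComplex (FpFun R)} (hS : S.Exact) [Epi S.g] :
    (ShortComplex.mk ((DA R).map S.g.op) ((DA R).map S.f.op)
      (by rw [← Functor.map_comp, ← op_comp, S.zero, op_zero, Functor.map_zero])).Exact := by
  rw [ShortComplex.exact_iff_exact_up_to_refinements]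
  intro Z z hz
  obtain ⟨y, hy⟩ := (toDR_bijective Z S.X₃).2 (hS.desc (toDR z) (by
    rw [← toDR_comp_DA_map]
    exact (congrArg toDR hz).trans (toDR_zero _ _)))
  refine ⟨Z, 𝟙 Z, inferInstance, y, ?_⟩
  rw [Category.id_comp]
  refine (toDR_bijective _ _).1 ?_
  rw [toDR_comp_DA_map, hy, hS.g_desc]

lemma exists_presentation_yon (F : FpFun R) :
    ∃ (X Y : RightMod R) (d : yon Y ⟶ yon X) (p : yon X ⟶ F) (w : d ≫ p = 0),
      Epi p ∧ (ShortComplex.mk d p w).Exact := by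
  have h : ∀ F : FpFun R, ∃ (X : RightMod R) (p : yon X ⟶ F), Epi p := by
    intro F
    obtain ⟨X, Y, a, p, hp⟩ := (isFP_iff F.obj).1 F.property
    exact ⟨X, ObjectProperty.homMk p, (IsFP (A := RightMod R)).ι.epi_of_epi_map
      (epi_of_app_surjective p fun M => (hp M).2)⟩
  obtain ⟨X, p, hp⟩ := h F
  obtain ⟨Y, q, hq⟩ := h (kernel p)
  refine ⟨X, Y, q ≫ kernel.ι p, p, by simp, hp, ?_⟩
  rw [ShortComplex.exact_iff_epi_kernel_lift]
  have h : kernel.lift p (q ≫ kernel.ι p) (by simp) = q := by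
    rw [← cancel_mono (kernel.ι p), kernel.lift_ι]
  change Epi (kernel.lift p (q ≫ kernel.ι p) (by simp))
  rwa [h]

variable (R) in
/-- The composite `D_A D_L`, as a covariant functor. -/
abbrev DAL : AddFun R ⥤ AddFun R := (DL R).rightOp ⋙ DA R

/-- The canonical morphism `D_L G ⟶ (G(R), -)`. -/
def lamDL (G : AddFun R) : (DL R).obj (op G) ⟶ yon ((evR R).obj G) :=
  ((evR R).op ⋙ Yon (RightMod R)).fromLeftDerivedZero.app (op G)

lemma lamDL_naturality {G H : AddFun R} (f : G ⟶ H) :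
    (DL R).map f.op ≫ lamDL G = lamDL H ≫ (Yon (RightMod R)).map ((evR R).map f).op :=
  ((evR R).op ⋙ Yon (RightMod R)).fromLeftDerivedZero.naturality f.op

instance (I : AddFun R) [Injective I] : IsIso (lamDL I) :=
  inferInstanceAs (IsIso (((evR R).op ⋙ Yon (RightMod R)).fromLeftDerivedZero.app (op I)))

/-- The canonical morphism `D_A(G(R), -) ≅ G(R) ⊗ - ⟶ G`. -/
def DAevTo (G : AddFun R) : (DA R).obj (op (yon ((evR R).obj G))) ⟶ G :=
  inv (tensorToDA ((evR R).obj G)) ≫ (tensorAdj R).counit.app G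

lemma DAevTo_naturality {G H : AddFun R} (f : G ⟶ H) :
    (DA R).map ((Yon (RightMod R)).map ((evR R).map f).op).op ≫ DAevTo H = DAevTo G ≫ f := by
  unfold DAevTo
  rw [reassoc_of% inv_tensorToDA_naturality ((evR R).map f), Category.assoc]
  exact congrArg (_ ≫ ·) ((tensorAdj R).counit.naturality f)

lemma DA_lamDL_naturality {G H : AddFun R} (f : G ⟶ H) :
    (DA R).map (lamDL G).op ≫ (DAL R).map f =
      (DA R).map ((Yon (RightMod R)).map ((evR R).map f).op).op ≫ (DA R).map (lamDL H).op := by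
  rw [← Functor.map_comp, ← op_comp, ← lamDL_naturality, op_comp, Functor.map_comp]
  rfl

instance (I : AddFun R) [Injective I] : IsIso (DAevTo I) := by
  unfold DAevTo
  infer_instance

/-- The isomorphism `D_A D_L I ≅ D_A(I(R), -) ≅ I(R) ⊗ - ≅ I` for an injective functor `I`. -/
def DALinj (I : AddFun R) [Injective I] : (DAL R).obj I ⟶ I :=
  inv ((DA R).map (lamDL I).op) ≫ DAevTo I

instance (I : AddFun R) [Injective I] : IsIso (DALinj I) := by
  unfold DALinj
  infer_instance

lemma DALinj_naturality {I J : AddFun R} [Injective I] [Injective J] (f : I ⟶ J) :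
    (DAL R).map f ≫ DALinj J = DALinj I ≫ f := by
  unfold DALinj
  rw [Category.assoc, IsIso.eq_inv_comp, ← DAevTo_naturality, ← Category.assoc,
    DA_lamDL_naturality, Category.assoc, IsIso.hom_inv_id_assoc]

/-- `D_L G` is the cokernel of `D_L I₁ ⟶ D_L I₀`; this is right exactness of the derived functor,
read outside the opposite category. -/
lemma exists_copresentation_DL (G : AddFun R) :
    ∃ (I₀ I₁ : AddFun R) (j : G ⟶ I₀) (d : I₀ ⟶ I₁) (w : j ≫ d = 0), Injective I₀ ∧
      Injective I₁ ∧ Mono j ∧ (ShortComplex.mk j d w).Exact ∧ Epi ((DL R).map j.op) ∧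
      ∀ {Z : FpFun R} (z : (DL R).obj (op I₀) ⟶ Z), (DL R).map d.op ≫ z = 0 →
        ∃ y : (DL R).obj (op G) ⟶ Z, (DL R).map j.op ≫ y = z := by
  obtain ⟨P₁, P₀, d, π, w, _, _, _, hex, hm, hz⟩ :=
    exists_presentation_leftDerived_zero ((evR R).op ⋙ Yon (RightMod R)) (op G)
  exact ⟨P₀.unop, P₁.unop, π.unop, d.unop, congrArg Quiver.Hom.unop w, inferInstance,
    inferInstance, inferInstance, hex.unop, hm, hz⟩

/-- `G` is the kernel of `I₀ ⟶ I₁`, and naturality of `DALinj` lets the map on `I₀` restrict to it.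
Compatibility with every map into an injective makes the result unique, independent of the
copresentation, and natural. -/
lemma exists_DALto (G : AddFun R) : ∃ e : (DAL R).obj G ⟶ G,
    ∀ (I : AddFun R) [Injective I] (j : G ⟶ I), e ≫ j = (DAL R).map j ≫ DALinj I := by
  obtain ⟨I₀, I₁, j, d, w, _, _, _, hex, _, _⟩ := exists_copresentation_DL G
  have h0 : ((DAL R).map j ≫ DALinj I₀) ≫ d = 0 := by
    rw [Category.assoc, ← DALinj_naturality, ← Functor.map_comp_assoc, w, Functor.map_zero,
      zero_comp]
  refine ⟨hex.lift ((DAL R).map j ≫ DALinj I₀) h0, fun I _ k => ?_⟩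
  have hl : hex.lift ((DAL R).map j ≫ DALinj I₀) h0 ≫ j = (DAL R).map j ≫ DALinj I₀ :=
    hex.lift_f _ h0
  have hk : j ≫ Injective.factorThru k j = k := Injective.comp_factorThru _ _
  rw [← hk, ← Category.assoc, hl, Category.assoc, ← DALinj_naturality, ← Functor.map_comp_assoc]

/-- The canonical morphism `D_A D_L G ⟶ G`. -/
def DALto (G : AddFun R) : (DAL R).obj G ⟶ G := (exists_DALto G).choose

lemma DALto_comp (G : AddFun R) {I : AddFun R} [Injective I] (j : G ⟶ I) :
    DALto G ≫ j = (DAL R).map j ≫ DALinj I :=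
  (exists_DALto G).choose_spec I j

lemma DALto_naturality {G H : AddFun R} (f : G ⟶ H) :
    (DAL R).map f ≫ DALto H = DALto G ≫ f := by
  rw [← cancel_mono (Injective.ι H), Category.assoc, DALto_comp, Category.assoc, DALto_comp,
    Functor.map_comp_assoc]

lemma DA_lamDL_DALto (G : AddFun R) : (DA R).map (lamDL G).op ≫ DALto G = DAevTo G := by
  rw [← cancel_mono (Injective.ι G), Category.assoc, DALto_comp, ← DAevTo_naturality,
    ← Category.assoc, DA_lamDL_naturality, Category.assoc]
  unfold DALinj
  rw [IsIso.hom_inv_id_assoc]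

/-- `D_A` turns the right exact sequence `D_L I₁ ⟶ D_L I₀ ⟶ D_L G ⟶ 0` into a left exact one. So
`D_A D_L G` is, like `G`, the kernel of `I₀ ⟶ I₁` up to `DALinj`. -/
instance isIso_DALto (G : AddFun R) : IsIso (DALto G) := by
  obtain ⟨I₀, I₁, j, d, w, _, _, _, hex, hm, hz⟩ := exists_copresentation_DL G
  have : Mono ((DAL R).map j) := mono_DA_map_of_epi ((DL R).map j.op)
  have : Mono (DALto G) := by
    have : Mono (DALto G ≫ j) := by
      rw [DALto_comp]
      infer_instance
    exact mono_of_mono (DALto G) j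
  have hS0 : (DL R).map d.op ≫ (DL R).map j.op = 0 := by
    rw [← Functor.map_comp, ← op_comp, w, op_zero, Functor.map_zero]
  have hS : (ShortComplex.mk _ _ hS0).Exact := by
    refine ShortComplex.exact_of_g_is_cokernel _ (CokernelCofork.IsColimit.ofπ _ _
      (fun z h => (hz z h).choose) (fun z h => (hz z h).choose_spec) fun z h m hm' => ?_)
    rw [← cancel_epi ((DL R).map j.op), (hz z h).choose_spec]
    exact hm'
  have hE := exact_DA hS
  have h0 : (j ≫ inv (DALinj I₀)) ≫ (DAL R).map d = 0 := by
    rw [← cancel_mono (DALinj I₁), Category.assoc, Category.assoc, DALinj_naturality,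
      IsIso.inv_hom_id_assoc, w, zero_comp]
  have : Mono ((DA R).map ((DL R).map j.op).op) := mono_DA_map_of_epi ((DL R).map j.op)
  let s : G ⟶ (DAL R).obj G := hE.lift (j ≫ inv (DALinj I₀)) h0
  have hs : s ≫ (DAL R).map j = j ≫ inv (DALinj I₀) := hE.lift_f _ h0
  have hs' : s ≫ DALto G = 𝟙 G := by
    rw [← cancel_mono j, Category.assoc, DALto_comp, ← Category.assoc, hs, Category.assoc, IsIso.inv_hom_id,
      Category.comp_id, Category.id_comp]
  exact ⟨s, by rw [← cancel_mono (DALto G), Category.assoc, hs', Category.comp_id,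
    Category.id_comp], hs'⟩

/-- The chain `Hom((G(R), -), (X, -)) = Hom(X, G(R)) = Hom(X ⊗ -, G) = Hom(D_A(X, -), G)`, by Yoneda
and `t ⊣ ev_R`. -/
lemma bijective_DAevTo_yon (G : AddFun R) (X : RightMod R) :
    Function.Bijective fun φ : yon ((evR R).obj G) ⟶ yon X => (DA R).map φ.op ≫ DAevTo G := by
  have h : ∀ u : X ⟶ (evR R).obj G, (DA R).map ((Yon (RightMod R)).map u.op).op ≫ DAevTo G =
      inv (tensorToDA X) ≫ ((tensorAdj R).homEquiv X G).symm u := by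
    intro u
    unfold DAevTo
    rw [reassoc_of% inv_tensorToDA_naturality u, Adjunction.homEquiv_counit]
  constructor
  · intro φ ψ e
    obtain ⟨u, rfl⟩ := (Yon (RightMod R)).map_surjective φ
    obtain ⟨v, rfl⟩ := (Yon (RightMod R)).map_surjective ψ
    have e' := (h u.unop).symm.trans (Eq.trans e (h v.unop))
    rw [cancel_epi, Equiv.apply_eq_iff_eq] at e'
    exact congrArg (Yon (RightMod R)).map (Quiver.Hom.unop_inj e')
  · intro ψ
    refine ⟨(Yon (RightMod R)).map ((tensorAdj R).homEquiv X G (tensorToDA X ≫ ψ)).op, ?_⟩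
    refine (h _).trans ?_
    rw [Equiv.symm_apply_apply, IsIso.inv_hom_id_assoc]

/-- Both sides are right exact in `F`: the first since `(I(R), -)` is projective, the second since
`D_A` is exact and `I` is injective. So the representable case is enough. -/
lemma bijective_DAevTo (I : AddFun R) [Injective I] (F : FpFun R) :
    Function.Bijective fun φ : yon ((evR R).obj I) ⟶ F => (DA R).map φ.op ≫ DAevTo I := by
  obtain ⟨X, Y, d, p, w, _, hS⟩ := exists_presentation_yon F
  have : Epi (ShortComplex.mk d p w).g := inferInstanceAs (Epi p)
  have hE := exact_DA hS
  constructor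
  · suffices h : ∀ φ : yon ((evR R).obj I) ⟶ F, (DA R).map φ.op ≫ DAevTo I = 0 → φ = 0 by
      intro φ ψ e
      refine sub_eq_zero.1 (h _ ?_)
      rw [op_sub, Functor.map_sub, Preadditive.sub_comp]
      exact sub_eq_zero.2 e
    intro φ hφ
    have hp : Projective.factorThru φ p ≫ p = φ := Projective.factorThru_comp _ _
    have h0 : (DA R).map p.op ≫ (DA R).map (Projective.factorThru φ p).op ≫ DAevTo I = 0 := by
      rw [← Functor.map_comp_assoc, ← op_comp, hp, hφ]
    -- The map to `I` vanishes on `D_A F`, hence extends from `D_A(X, -)` over `D_A(Y, -)`. The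
    -- extension comes from some `ψ`, so the lift of `φ` factors through `d` and dies in `F`.
    obtain ⟨ψ, hψ⟩ := (bijective_DAevTo_yon I Y).2 (hE.descToInjective _ h0)
    have h1 : ψ ≫ d = Projective.factorThru φ p := (bijective_DAevTo_yon I X).1 (by
      change (DA R).map (ψ ≫ d).op ≫ DAevTo I = _
      rw [op_comp, Functor.map_comp, Category.assoc]
      exact (congrArg (_ ≫ ·) hψ).trans (hE.comp_descToInjective _ h0))
    rw [← hp, ← h1, Category.assoc, w, comp_zero]
  · intro ψ
    obtain ⟨φ, hφ⟩ := (bijective_DAevTo_yon I X).2 (Injective.factorThru ψ ((DA R).map p.op))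
    refine ⟨φ ≫ p, ?_⟩
    change (DA R).map (φ ≫ p).op ≫ DAevTo I = ψ
    rw [op_comp, Functor.map_comp, Category.assoc]
    exact (congrArg (_ ≫ ·) hφ).trans (Injective.comp_factorThru _ _)

/-- The morphism `D_A F ⟶ G` corresponding to `D_L G ⟶ F`. -/
def fromDA {G : AddFun R} {F : FpFun R} (f : (DL R).obj (op G) ⟶ F) :
    (DA R).obj (op F) ⟶ G :=
  (DA R).map f.op ≫ DALto G

lemma fromDA_comp {G : AddFun R} {F F' : FpFun R} (f : (DL R).obj (op G) ⟶ F) (g : F ⟶ F') :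
    fromDA (f ≫ g) = (DA R).map g.op ≫ fromDA f := by
  simp only [fromDA, op_comp, Functor.map_comp, Category.assoc]

lemma fromDA_DL_map {G H : AddFun R} {F : FpFun R} (f : G ⟶ H) (g : (DL R).obj (op G) ⟶ F) :
    fromDA ((DL R).map f.op ≫ g) = fromDA g ≫ f := by
  rw [fromDA_comp]
  unfold fromDA
  rw [Category.assoc, ← DALto_naturality]
  rfl

lemma fromDA_zero (G : AddFun R) (F : FpFun R) : fromDA (0 : (DL R).obj (op G) ⟶ F) = 0 := by
  rw [fromDA, op_zero, Functor.map_zero, zero_comp]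

/-- Composing with the isomorphism `lamDL I` reduces this to `bijective_DAevTo`. -/
lemma fromDA_bijective_of_injective (I : AddFun R) [Injective I] (F : FpFun R) :
    Function.Bijective (fromDA : ((DL R).obj (op I) ⟶ F) → _) := by
  have h : ∀ φ : yon ((evR R).obj I) ⟶ F, fromDA (lamDL I ≫ φ) = (DA R).map φ.op ≫ DAevTo I := by
    intro φ
    rw [fromDA_comp, fromDA, DA_lamDL_DALto]
  have hc : (fun f : (DL R).obj (op I) ⟶ F => fromDA f) =
      (fun φ : yon ((evR R).obj I) ⟶ F => (DA R).map φ.op ≫ DAevTo I) ∘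
        fun f => inv (lamDL I) ≫ f := by
    funext f
    rw [Function.comp, ← h, IsIso.hom_inv_id_assoc]
  change Function.Bijective fun f : (DL R).obj (op I) ⟶ F => fromDA f
  rw [hc]
  refine (bijective_DAevTo I F).comp ⟨fun f g e => (cancel_epi _).1 e, fun φ => ⟨lamDL I ≫ φ, ?_⟩⟩
  exact IsIso.inv_hom_id_assoc _ _

/-- `Hom(D_L -, F)` and `Hom(D_A F, -)` both send the copresentation of `G` to a left exact
sequence, so injective `G` suffice. -/
lemma fromDA_bijective (G : AddFun R) (F : FpFun R) :
    Function.Bijective (fromDA : ((DL R).obj (op G) ⟶ F) → _) := by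
  obtain ⟨I₀, I₁, j, d, w, _, _, _, _, _, hz⟩ := exists_copresentation_DL G
  constructor
  · intro f g e
    rw [← cancel_epi ((DL R).map j.op)]
    refine (fromDA_bijective_of_injective I₀ F).1 ?_
    rw [fromDA_DL_map, fromDA_DL_map, e]
  · intro ψ
    obtain ⟨g, hg⟩ := (fromDA_bijective_of_injective I₀ F).2 (ψ ≫ j)
    obtain ⟨f, hf⟩ := hz g ((fromDA_bijective_of_injective I₁ F).1 (by
      rw [fromDA_DL_map, hg, Category.assoc, w, comp_zero, fromDA_zero]))
    exact ⟨f, by rw [← cancel_mono j, ← fromDA_DL_map, hf, hg]⟩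

variable (R) in
/-- The adjunction `D_L ⊣ D_A`. -/
def adjDLDA : DL R ⊣ (DA R).rightOp :=
  Adjunction.mkOfHomEquiv
    { homEquiv := fun G F => Equiv.ofBijective
        (fun f : (DL R).obj G ⟶ F => ((fromDA f).op : G ⟶ (DA R).rightOp.obj F))
        ((opEquiv _ _).symm.bijective.comp (fromDA_bijective G.unop F))
      homEquiv_naturality_left_symm := fun {G G' F} f g => by
        rw [Equiv.symm_apply_eq]
        refine Eq.trans ?_ (congrArg Quiver.Hom.op (fromDA_DL_map f.unop _)).symm
        exact congrArg (f ≫ ·) ((Equiv.ofBijective _ ((opEquiv _ _).symm.bijective.comp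
          (fromDA_bijective G'.unop F))).apply_symm_apply g).symm
      homEquiv_naturality_right := fun {G F F'} f g => congrArg Quiver.Hom.op (fromDA_comp f g) }

lemma adjDLDA_unit_app (G : AddFun R) : (adjDLDA R).unit.app (op G) = (DALto G).op := by
  change (fromDA (𝟙 ((DL R).obj (op G)))).op = _
  unfold fromDA
  rw [op_id, CategoryTheory.Functor.map_id, Category.id_comp]

/-- After cancelling the naturality squares, this is a triangle identity of `t ⊣ ev_R`. It
identifies `γ` on representables with the counit of `D_L ⊣ D_A`. -/
lemma fromDA_gammaRep (X : RightMod R) :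
    fromDA (gammaRep X) = 𝟙 ((DA R).obj (op (yon X))) := by
  have h1 : fromDA (lamDL ((tensorEmb R).obj X)) = DAevTo _ := DA_lamDL_DALto _
  have h2 : gammaRep X = (DL R).map (tensorToDA X).op ≫ lamDL ((tensorEmb R).obj X) ≫
    (Yon (RightMod R)).map (toEvTensor X).op := rfl
  rw [h2, fromDA_DL_map, fromDA_comp, h1]
  unfold DAevTo
  rw [reassoc_of% inv_tensorToDA_naturality (toEvTensor X), ← tensorAdj_unit_app]
  have h3 := (tensorAdj R).left_triangle_components X
  rw [h3, Category.comp_id, IsIso.inv_hom_id]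

lemma adjDLDA_counit_app_yon (X : RightMod R) : (adjDLDA R).counit.app (yon X) = gammaRep X := by
  refine ((adjDLDA R).homEquiv _ _).injective ?_
  rw [Adjunction.homEquiv_unit, Adjunction.homEquiv_unit, (adjDLDA R).right_triangle_components]
  refine Eq.trans ?_ (congrArg (· ≫ _) (adjDLDA_unit_app _)).symm
  exact (congrArg Quiver.Hom.op (fromDA_gammaRep X)).symm

end LeftAdjoint

/-! ### The kernel of a functor with adjoints on both sides. -/

section KernelOfFunctor
variable {B : Type*} {C : Type*} [Category* B] [Category* C] {D : B ⥤ C} {L R : C ⥤ B}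
  {P : ObjectProperty B}

lemma isZero_map_of_isLimit [HasZeroMorphisms C] (adjL : L ⊣ D) {J : Type*} [Category* J]
    {K : J ⥤ B} {c : Cone K}
    (hc : IsLimit c) (hK : ∀ j, IsZero (D.obj (K.obj j))) : IsZero (D.obj c.pt) := by
  have := adjL.rightAdjoint_preservesLimits
  rw [IsZero.iff_id_eq_zero]
  exact (isLimitOfPreserves D hc).hom_ext fun j => (hK j).eq_of_tgt _ _

lemma isClosedUnderIsomorphisms_of_iff_isZero (hP : ∀ F, P F ↔ IsZero (D.obj F)) :
    P.IsClosedUnderIsomorphisms where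
  of_iso e h := (hP _).2 (((hP _).1 h).of_iso (D.mapIso e.symm))

lemma isClosedUnderFiniteProducts_of_iff_isZero [HasZeroMorphisms C]
    (adjL : L ⊣ D) (hP : ∀ F, P F ↔ IsZero (D.obj F)) : P.IsClosedUnderFiniteProducts where
  isClosedUnderLimitsOfShape J _ := by
    refine ⟨?_⟩
    rintro F ⟨h⟩
    exact (hP _).2 (isZero_map_of_isLimit adjL h.isLimit fun j => (hP _).1 (h.prop_diag_obj j))

variable [Abelian B] [Abelian C]

/-- By the triangle identity `D` of the counit is split epi, so `D` of the cokernel projection is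
zero; it is also epi, since `D` preserves colimits. -/
lemma isZero_map_cokernel_counit (adjL : L ⊣ D) (adjR : D ⊣ R) (F : B) :
    IsZero (D.obj ((cokernel adjL.counit).obj F)) := by
  have := adjR.leftAdjoint_preservesColimits
  have h : adjL.unit.app (D.obj F) ≫ D.map (adjL.counit.app F) = 𝟙 _ :=
    adjL.right_triangle_components F
  have h0 : adjL.counit.app F ≫ (cokernel.π adjL.counit).app F = 0 :=
    congr_app (cokernel.condition adjL.counit) F
  have h1 : D.map ((cokernel.π adjL.counit).app F) = 0 := by
    refine (Category.id_comp _).symm.trans ((congrArg (· ≫ _) h.symm).trans ?_)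
    rw [Category.assoc, ← Functor.map_comp, h0, Functor.map_zero, comp_zero]
  rw [IsZero.iff_id_eq_zero, ← cancel_epi (D.map ((cokernel.π adjL.counit).app F)), h1,
    zero_comp, zero_comp]

lemma isZero_map_kernel_unit (adjL : L ⊣ D) (adjR : D ⊣ R) (F : B) :
    IsZero (D.obj ((kernel adjR.unit).obj F)) := by
  have := adjL.rightAdjoint_preservesLimits
  have h : D.map (adjR.unit.app F) ≫ adjR.counit.app (D.obj F) = 𝟙 _ :=
    adjR.left_triangle_components F
  have h0 : (kernel.ι adjR.unit).app F ≫ adjR.unit.app F = 0 :=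
    congr_app (kernel.condition adjR.unit) F
  have h1 : D.map ((kernel.ι adjR.unit).app F) = 0 := by
    rw [← Category.comp_id (D.map _), ← h, ← Category.assoc, ← Functor.map_comp, h0,
      Functor.map_zero, zero_comp]
  rw [IsZero.iff_id_eq_zero, ← cancel_mono (D.map ((kernel.ι adjR.unit).app F)), h1,
    comp_zero, comp_zero]

lemma containsZero_of_iff_isZero (adjL : L ⊣ D) (hP : ∀ F, P F ↔ IsZero (D.obj F)) :
    P.ContainsZero where
  exists_zero := by
    have := adjL.rightAdjoint_preservesLimits
    obtain ⟨Z, hZ⟩ := HasZeroObject.zero (C := B)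
    exact ⟨Z, hZ, (hP Z).2 (D.map_isZero hZ)⟩

lemma isClosedUnderKernels_of_iff_isZero (adjL : L ⊣ D) (hP : ∀ F, P F ↔ IsZero (D.obj F)) :
    P.IsClosedUnderKernels where
  kernels_le := by
    rintro _ ⟨f, k, hk, hf⟩
    refine (hP _).2 (isZero_map_of_isLimit adjL hk ?_)
    rintro (_ | _)
    · exact (hP _).1 hf.1
    · exact (hP _).1 hf.2

lemma isClosedUnderCokernels_of_iff_isZero (adjR : D ⊣ R) (hP : ∀ F, P F ↔ IsZero (D.obj F)) :
    P.IsClosedUnderCokernels where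
  cokernels_le := by
    rintro _ ⟨f, k, hk, hf⟩
    have := Cofork.IsColimit.epi hk
    have := adjR.leftAdjoint_preservesColimits
    exact (hP _).2 (IsZero.of_epi (D.map k.π) ((hP _).1 hf.2))

/-- Maps from `coker(L D F ⟶ F)` to an object of the kernel of `D` are maps from `F`. -/
def cokernelCounitEquiv (adjL : L ⊣ D) (hP : ∀ F, P F → IsZero (D.obj F))
    (h : ∀ F, P ((cokernel adjL.counit).obj F)) (F : B) (K : P.FullSubcategory) :
    ((ObjectProperty.lift P (cokernel adjL.counit) h).obj F ⟶ K) ≃ (F ⟶ K.obj) :=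
  Equiv.ofBijective (fun f => (cokernel.π adjL.counit).app F ≫ f.hom) (by
    constructor
    · intro f g e
      exact ObjectProperty.hom_ext _ ((cancel_epi _).1 e)
    · intro g
      -- `Hom(L D F, K) = Hom(D F, D K) = 0`, so every map from `F` to `K` kills the counit.
      have h0 : adjL.counit.app F ≫ g = 0 :=
        (adjL.homEquiv _ _).injective ((hP _ K.property).eq_of_tgt _ _)
      -- Cokernels of natural transformations are computed pointwise, so `g` factors through the
      -- value at `F`.
      let E := (evaluation B B).obj F
      let d : (cokernel adjL.counit).obj F ⟶ K.obj :=
        (isColimitOfHasCokernelOfPreservesColimit E adjL.counit).desc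
          (CokernelCofork.ofπ (f := E.map adjL.counit) g h0)
      have hd : (cokernel.π adjL.counit).app F ≫ d = g :=
        (isColimitOfHasCokernelOfPreservesColimit E adjL.counit).fac _ WalkingParallelPair.one
      exact ⟨ObjectProperty.homMk d, hd⟩)

/-- `F ↦ coker(L D F ⟶ F)` is left adjoint to the inclusion of the kernel of `D`. -/
def cokernelCounitAdj (adjL : L ⊣ D) (hP : ∀ F, P F → IsZero (D.obj F))
    (h : ∀ F, P ((cokernel adjL.counit).obj F)) :
    ObjectProperty.lift P (cokernel adjL.counit) h ⊣ P.ι :=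
  Adjunction.mkOfHomEquiv
    { homEquiv := cokernelCounitEquiv adjL hP h
      homEquiv_naturality_left_symm := fun {F F' K} f g => by
        rw [Equiv.symm_apply_eq]
        refine Eq.trans ?_ ((cokernel.π adjL.counit).naturality_assoc f _)
        exact congrArg (f ≫ ·) ((cokernelCounitEquiv adjL hP h F' K).apply_symm_apply g).symm
      homEquiv_naturality_right := fun f g => (Category.assoc _ _ _).symm }

/-- Maps from an object of the kernel of `D` to `ker(F ⟶ R D F)` are maps to `F`. -/
def kernelUnitEquiv (adjR : D ⊣ R) (hP : ∀ F, P F → IsZero (D.obj F))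
    (h : ∀ F, P ((kernel adjR.unit).obj F)) (K : P.FullSubcategory) (F : B) :
    (K ⟶ (ObjectProperty.lift P (kernel adjR.unit) h).obj F) ≃ (K.obj ⟶ F) :=
  Equiv.ofBijective (fun f => f.hom ≫ (kernel.ι adjR.unit).app F) (by
    constructor
    · intro f g e
      exact ObjectProperty.hom_ext _ ((cancel_mono _).1 e)
    · intro g
      -- Dually, `Hom(K, R D F) = Hom(D K, D F) = 0`.
      have h0 : g ≫ adjR.unit.app F = 0 :=
        (adjR.homEquiv _ _).symm.injective ((hP _ K.property).eq_of_src _ _)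
      let E := (evaluation B B).obj F
      let d : K.obj ⟶ (kernel adjR.unit).obj F :=
        (isLimitOfHasKernelOfPreservesLimit E adjR.unit).lift
          (KernelFork.ofι (f := E.map adjR.unit) g h0)
      have hd : d ≫ (kernel.ι adjR.unit).app F = g :=
        (isLimitOfHasKernelOfPreservesLimit E adjR.unit).fac _ WalkingParallelPair.zero
      exact ⟨ObjectProperty.homMk d, hd⟩)

/-- `F ↦ ker(F ⟶ R D F)` is right adjoint to the inclusion of the kernel of `D`. -/
def kernelUnitAdj (adjR : D ⊣ R) (hP : ∀ F, P F → IsZero (D.obj F))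
    (h : ∀ F, P ((kernel adjR.unit).obj F)) : P.ι ⊣ ObjectProperty.lift P (kernel adjR.unit) h :=
  Adjunction.mkOfHomEquiv
    { homEquiv := fun K F => (kernelUnitEquiv adjR hP h K F).symm
      homEquiv_naturality_left_symm := fun f g => Category.assoc _ _ _
      homEquiv_naturality_right := fun {K F F'} f g => by
        refine (Equiv.symm_apply_eq _).2 ?_
        refine Eq.symm ((Category.assoc _ _ _).trans ((congrArg (_ ≫ ·)
          ((kernel.ι adjR.unit).naturality g)).trans ?_))
        exact (Category.assoc _ _ _).symm.trans
          (congrArg (· ≫ g) ((kernelUnitEquiv adjR hP h K F).apply_symm_apply f)) }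

end KernelOfFunctor

/-! ### Assembling the recollement. -/

section Main
variable (R : Type u) [Ring R]

lemma kerDA_iff (F : FpFun R) : kerDA R F ↔ IsZero ((DA R).rightOp.obj F) :=
  ⟨fun h => h.op, fun h => h.unop⟩

/-- Together, these closure properties make `ker(D_A)` abelian with the preadditive structure
inherited from `fp(Mod(R), Ab)`. -/
instance : (kerDA R).ContainsZero := containsZero_of_iff_isZero (adjDLDA R) (kerDA_iff R)

instance : (kerDA R).IsClosedUnderIsomorphisms :=
  isClosedUnderIsomorphisms_of_iff_isZero (kerDA_iff R)

instance : (kerDA R).IsClosedUnderKernels :=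
  isClosedUnderKernels_of_iff_isZero (adjDLDA R) (kerDA_iff R)

instance : (kerDA R).IsClosedUnderCokernels :=
  isClosedUnderCokernels_of_iff_isZero (adjDADR R) (kerDA_iff R)

instance : (kerDA R).IsClosedUnderFiniteProducts :=
  isClosedUnderFiniteProducts_of_iff_isZero (adjDLDA R) (kerDA_iff R)

instance : IsIso (adjDLDA R).unit := by
  have : ∀ G, IsIso ((adjDLDA R).unit.app G) := fun G => by
    have h : (adjDLDA R).unit.app G = (DALto G.unop).op := adjDLDA_unit_app G.unop
    rw [h]
    infer_instance
  exact NatIso.isIso_of_isIso_app _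

/-- In an adjoint triple the outer adjoints are fully faithful simultaneously, so `D_A D_L ≅ 1`
already gives `D_A D_R ≅ 1`. -/
lemma isIso_adjDADR_counit : IsIso (adjDADR R).counit :=
  (Adjunction.Triple.mk (adjDLDA R) (adjDADR R)).isIso_unit_iff_isIso_counit.1 inferInstance

lemma kerDA_cokernel_counit (F : FpFun R) : kerDA R ((cokernel (adjDLDA R).counit).obj F) :=
  (kerDA_iff R _).2 (isZero_map_cokernel_counit (adjDLDA R) (adjDADR R) F)

lemma kerDA_kernel_unit (F : FpFun R) : kerDA R ((kernel (adjDADR R).unit).obj F) :=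
  (kerDA_iff R _).2 (isZero_map_kernel_unit (adjDLDA R) (adjDADR R) F)

/-- The recollement of `fp(Mod(R), Ab)`. -/
def recollementDA : Recollement (kerDA R).ι (upperP R (adjDLDA R).counit (kerDA_cokernel_counit R))
    (lowerQ R (adjDADR R).unit (kerDA_kernel_unit R)) (DA R).rightOp (DL R) (DR R isFP_DRfun) :=
  have hP := fun F => (kerDA_iff R F).1
  let adjL := cokernelCounitAdj (adjDLDA R) hP (kerDA_cokernel_counit R)
  let adjR := kernelUnitAdj (adjDADR R) hP (kerDA_kernel_unit R)
  { abelian_left := ⟨inferInstance, rfl⟩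
    abelian_middle := ⟨inferInstance, rfl⟩
    abelian_right := ⟨inferInstance, rfl⟩
    additive_i := inferInstance
    additive_iL := adjL.left_adjoint_additive
    additive_iR := adjR.right_adjoint_additive
    additive_f := inferInstance
    additive_fL := inferInstance
    additive_fR := (adjDADR R).right_adjoint_additive
    adjfL := adjDLDA R
    adjfR := adjDADR R
    isIso_unit_fL := inferInstance
    isIso_counit_fR := isIso_adjDADR_counit R
    adjiL := adjL
    adjiR := adjR
    isIso_counit_iL := Adjunction.counit_isIso_of_R_fully_faithful adjL
    isIso_unit_iR := Adjunction.unit_isIso_of_L_fully_faithful adjR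
    full_i := inferInstance
    faithful_i := inferInstance
    essImage_i := fun F => by
      rw [← kerDA_iff]
      exact ⟨fun ⟨K, ⟨e⟩⟩ => (kerDA R).prop_of_iso e K.property, fun h => ⟨⟨F, h⟩, ⟨Iso.refl _⟩⟩⟩ }

end Main

end AGJ
end

theorem mainTheorem4 (R : Type u) [Ring R] :
    ∃ (hR : ∀ G, AGJ.IsFP ((AGJ.DRfun R).obj G))
      (adjL : AGJ.DL R ⊣ (AGJ.DA R).rightOp)
      (adjR : (AGJ.DA R).rightOp ⊣ AGJ.DR R hR)
      (hp : ∀ F, AGJ.kerDA R ((cokernel adjL.counit).obj F))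
      (hq : ∀ F, AGJ.kerDA R ((kernel adjR.unit).obj F))
      (ρ : AGJ.Recollement (AGJ.kerDA R).ι (AGJ.upperP R adjL.counit hp)
        (AGJ.lowerQ R adjR.unit hq) (AGJ.DA R).rightOp (AGJ.DL R) (AGJ.DR R hR)),
      ρ.adjfL = adjL ∧ ρ.adjfR = adjR ∧
      (∀ X, adjL.counit.app (AGJ.yon X) = AGJ.gammaRep X) ∧
      (∀ X, (AGJ.resSmall R).map (AGJ.tensorToDA X) ≫ AGJ.deltaRep adjR.unit X = 𝟙 _) :=
  ⟨AGJ.isFP_DRfun, AGJ.adjDLDA R, AGJ.adjDADR R, AGJ.kerDA_cokernel_counit R,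
    AGJ.kerDA_kernel_unit R, AGJ.recollementDA R, rfl, rfl, AGJ.adjDLDA_counit_app_yon,
    AGJ.resSmall_map_tensorToDA_deltaRep⟩
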